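/- A $4$-uniform hypergraph of order $n$ is a set $E(G)$ of $4$-element subsets (hyperedges) of an $n$-element vertex set; isolated vertices are allowed. The $4$-uniform bow tie $B_4$ is the hypergraph with $7$ vertices and two hyperedges of size $4$ that share exactly one vertex. A $4$-uniform hypergraph $G$ is $B_4$-saturated if it contains no copy of $B_4$ (as a not necessarily induced subhypergraph), but adding to $G$ any $4$-element set of vertices that is not a hyperedge of $G$ creates a copy of $B_4$. Let $\mathrm{sat}_4(n,B_4)$ denote the minimum number of hyperedges of a $B_4$-saturated $4$-uniform hypergraph of order $n$. Theorem. For every integer $n\ge 0$, \[ \mathrm{sat}_4(n,B_4)=\begin{cases}\binom n4 & \text{if } n\le 6,\\ n & \text{if } n\in\{7,8\},\\ n-3 & \text{if } n\ge 9.\end{cases} \] Moreover, the extremal hypergraphs for $n=7$ and $n=8$ are unique up to isomorphism: (a) a $4$-uniform hypergraph of order $7$ is $B_4$-saturated with exactly $7$ hyperedges if and only if it is isomorphic to the hypergraph whose hyperedges are the complements of the seven lines of the Fano plane; (b) a $4$-uniform hypergraph of order $8$ is $B_4$-saturated with exactly $8$ hyperedges if and only if it is isomorphic to the hypergraph with vertex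 set $\{1,\dots,8\}$ and hyperedge set \[ \left\{A\in\tbinom{\{1,\dots,6\}}{4} : |A\cap\{1,2,3,4\}|\in\{2,4\}\right\}\cup\{\{5,6,7,8\}\}. \] -/

import Mathlib

namespace BowTieSaturation

/-! A finite hypergraph with vertex set `V` is given by its finite set of hyperedges,
`G : Finset (Finset V)`. Vertices lying in no hyperedge are allowed. -/

/-- `G` contains a copy of `F`: there is an injective map of vertices carrying every hyperedge
of `F` to a hyperedge of `G` (a not necessarily induced subhypergraph isomorphic to `F`). -/
def Contains {V W : Type*} (F : Finset (Finset W)) (G : Finset (Finset V)) : Prop :=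
  ∃ f : W ↪ V, ∀ e ∈ F, e.map f ∈ G

/-- `G` is an `F`-saturated `k`-uniform hypergraph on the vertex set `V`: all hyperedges have
`k` vertices, there is no copy of `F` in `G`, and adding any missing `k`-set as a hyperedge
creates a copy of `F`. -/
structure IsSaturated {V W : Type*} [DecidableEq V] (k : ℕ) (F : Finset (Finset W))
    (G : Finset (Finset V)) : Prop where
  uniform : ∀ e ∈ G, e.card = k
  free : ¬ Contains F G
  saturated : ∀ e : Finset V, e.card = k → e ∉ G → Contains F (insert e G)

/-- The set of numbers of hyperedges of `F`-saturated `k`-uniform hypergraphs of order `n`. -/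
def saturatedSizes {W : Type*} (k n : ℕ) (F : Finset (Finset W)) : Set ℕ :=
  {m | ∃ G : Finset (Finset (Fin n)), IsSaturated k F G ∧ G.card = m}

/-- `m` is the saturation number `sat_k(n, F)`: the minimum number of hyperedges of an
`F`-saturated `k`-uniform hypergraph of order `n` (in particular this minimum is attained). -/
def IsSatNumber {W : Type*} (k n : ℕ) (F : Finset (Finset W)) (m : ℕ) : Prop :=
  IsLeast (saturatedSizes k n F) m

/-- The `k`-uniform bow tie (for `k ≥ 1`), on the `2k - 1` vertices `0, …, 2k - 2`: its two
hyperedges are `{0, …, k - 1}` and `{k - 1, …, 2k - 2}`, which share exactly the vertex `k - 1`. -/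
def bowTie (k : ℕ) : Finset (Finset (Fin (2 * k - 1))) :=
  {Finset.univ.filter (fun i => i.val < k), Finset.univ.filter (fun i => k - 1 ≤ i.val)}

/-- Two hypergraphs are isomorphic: some bijection of the vertex sets maps the hyperedges of one
exactly onto the hyperedges of the other. -/
def Isomorphic {V V' : Type*} (G : Finset (Finset V)) (G' : Finset (Finset V')) : Prop :=
  ∃ σ : V ≃ V', ∀ e : Finset V, e ∈ G ↔ e.map σ.toEmbedding ∈ G'

/-- The Fano plane on the points `ℤ/7`: its seven lines are the translates `{i, i + 1, i + 3}`
(addition in `Fin 7` is modulo `7`). -/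
def fanoPlane : Finset (Finset (Fin 7)) :=
  Finset.univ.image (fun i : Fin 7 => {i, i + 1, i + 3})

/-- The hypergraph of the complements of the seven lines of the Fano plane. -/
def fanoComplement : Finset (Finset (Fin 7)) :=
  fanoPlane.image (fun e => eᶜ)

/-- The hypergraph on eight vertices `0, …, 7` whose hyperedges are the `4`-subsets of
`{0, …, 5}` with two or four elements in `{0, 1, 2, 3}`, and the set `{4, 5, 6, 7}`. -/
def extremalEight : Finset (Finset (Fin 8)) :=
  insert {4, 5, 6, 7}
    ((Finset.powersetCard 4 ({0, 1, 2, 3, 4, 5} : Finset (Fin 8))).filter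
      (fun e => (e ∩ {0, 1, 2, 3}).card = 2 ∨ (e ∩ {0, 1, 2, 3}).card = 4))

end BowTieSaturation

/-! Two `4`-sets span a bow tie exactly when they meet in a single vertex. Hence saturation means
that the hyperedges are precisely the `4`-sets that no hyperedge meets in exactly one vertex
(`isSaturated_iff`, `Maximal4`). On at most six vertices no two `4`-sets meet in one vertex, so
every `4`-set is a hyperedge.

Lower bound `n - 3` (`Maximal4.card_univ_le`). Two vertices are twins if they lie in the same
hyperedges, that is, if their pair is unblocked. Let `D` be the set of vertices with a twin, `A` the
covered vertices without twin, and `O` the isolated vertices without twin; `O` has at most one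
element, as two isolated vertices are twins. The vertices of `A` have distinct representatives among
the hyperedges, and none of these lies inside `D`. Any two disjoint twin pairs form a hyperedge,
which yields `|D| - 3` hyperedges inside `D` once `|D| ≥ 4` (`TwinPairs.card_le`). Only the case of
an isolated vertex still lacks one hyperedge. There every triple of other vertices is blocked, and
this produces either a hyperedge not needed as a representative (`Maximal4.exists_spare`) or one
more inside `D`; if `|D| ≤ 3`, it excludes `|D| = 3`.

The representatives come from cores (`IsCore`). A hyperedge through a core vertex without twin meets
the core in at least three vertices, so it adds at most one new vertex and can represent that vertex
itself. Cores therefore grow to closed ones, and closed cores can be glued (`exists_matching`). It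
remains to find a core around each covered vertex without twin (`Maximal4.exists_core`). This is a
finite case distinction that starts from one hyperedge: a chosen set of named vertices is either
unblocked, or blocked by a hyperedge with one of finitely many traces on the named vertices. The
tree of cases is stored as a certificate, evaluated by the kernel and justified by `of_checkSteps`.

The same machinery treats orders `7` and `8`: a maximal hypergraph with at most `n` hyperedges
contains the extremal one, and one maximal family contained in another equals it. For the upper
bound, orders `9`, `10`, `11` have explicit examples. For `n ≥ 12` a frame of seven hyperedges on
ten vertices is completed by all `{7, 8, 9, x}` with `x` outside the frame. -/

namespace BowTieSaturation

/-! ### Families of sets without singleton intersections -/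

section Unblocked

variable {V : Type*} [DecidableEq V]

/-- The set `s` meets no hyperedge of `G` in exactly one vertex. -/
def Unblocked (G : Finset (Finset V)) (s : Finset V) : Prop :=
  ∀ f ∈ G, (f ∩ s).card ≠ 1

/-- Concrete form of bow tie saturation: the hyperedges are exactly the unblocked `4`-sets. -/
structure Maximal4 (G : Finset (Finset V)) : Prop where
  card_eq : ∀ e ∈ G, e.card = 4
  unblocked : ∀ e ∈ G, Unblocked G e
  mem : ∀ e : Finset V, e.card = 4 → Unblocked G e → e ∈ G

end Unblocked

/-! ### Sets of natural numbers as bit masks -/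

/-- The set of positions of the nonzero bits of `m`. -/
def bits (m : ℕ) : Finset ℕ := (Finset.range m).filter (fun i => m.testBit i)

theorem mem_bits {m i : ℕ} : i ∈ bits m ↔ m.testBit i = true := by
  simp only [bits, Finset.mem_filter, Finset.mem_range, and_iff_right_iff_imp]
  intro h
  exact lt_of_lt_of_le Nat.lt_two_pow_self (Nat.ge_two_pow_of_testBit h)

theorem bits_land (m n : ℕ) : bits (m &&& n) = bits m ∩ bits n := by
  ext i; simp [mem_bits]

theorem bits_lor (m n : ℕ) : bits (m ||| n) = bits m ∪ bits n := by
  ext i; simp [mem_bits]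

theorem bits_injective : Function.Injective bits := by
  intro m n h
  apply Nat.eq_of_testBit_eq
  intro i
  have := Finset.ext_iff.1 h i
  rw [mem_bits, mem_bits] at this
  exact Bool.eq_iff_iff.2 this

theorem bits_two_pow (a : ℕ) : bits (2 ^ a) = {a} := by
  ext i; simp [mem_bits, Nat.testBit_two_pow, eq_comm]

theorem lt_of_mem_bits {m k i : ℕ} (hm : m < 2 ^ k) (h : i ∈ bits m) : i < k := by
  by_contra hk
  rw [mem_bits] at h
  have := Nat.testBit_lt_two_pow (lt_of_lt_of_le hm (Nat.pow_le_pow_right two_pos (not_lt.1 hk)))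
  rw [this] at h
  cases h

theorem exists_bits (s : Finset ℕ) {k : ℕ} (hs : ∀ i ∈ s, i < k) : ∃ m < 2 ^ k, bits m = s := by
  refine ⟨Nat.ofBits (fun i : Fin k => decide (i.val ∈ s)), Nat.ofBits_lt_two_pow _, ?_⟩
  ext i
  rw [mem_bits]
  by_cases h : i < k
  · rw [Nat.testBit_ofBits_lt _ _ h]; simp
  · rw [Nat.testBit_ofBits_ge _ _ (not_lt.1 h)]
    simp only [Bool.false_eq_true, false_iff]
    exact fun h' => h (hs i h')

/-- Whether `x` is a power of two, i.e. the mask of a singleton. -/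
def isPow (x : ℕ) : Bool := x == 2 ^ x.log2

/-- The mask `0` is rejected because `Nat.log2 0 = 0`, so that it is compared with `1`. -/
theorem isPow_iff {x : ℕ} : isPow x = true ↔ (bits x).card = 1 := by
  rw [Finset.card_eq_one]
  constructor
  · intro h
    refine ⟨x.log2, ?_⟩
    rw [← bits_two_pow, ← eq_of_beq h]
  · rintro ⟨a, ha⟩
    rw [← bits_two_pow] at ha
    have := bits_injective ha
    simp [isPow, this]

/-- The number of nonzero bits of `m` among the first `k`. -/
def popCount (k m : ℕ) : ℕ := (List.range k).countP (fun i => m.testBit i)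

theorem popCount_eq {k m : ℕ} (hm : m < 2 ^ k) : popCount k m = (bits m).card := by
  have : bits m = ((List.range k).filter (fun i => m.testBit i)).toFinset := by
    ext i
    simp only [List.mem_toFinset, List.mem_filter, List.mem_range]
    exact ⟨fun h => ⟨lt_of_mem_bits hm h, mem_bits.1 h⟩, fun h => mem_bits.2 h.2⟩
  rw [this, List.toFinset_card_of_nodup (List.nodup_range.filter _), popCount,
    List.countP_eq_length_filter]

/-- The mask of the image of the set with mask `m` under `σ`. -/
def mapMask (k : ℕ) (σ : ℕ → ℕ) (m : ℕ) : ℕ :=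
  (List.range k).foldr (fun i acc => bif m.testBit i then 2 ^ σ i ||| acc else acc) 0

theorem bits_mapMask {k : ℕ} (σ : ℕ → ℕ) {m : ℕ} (hm : m < 2 ^ k) :
    bits (mapMask k σ m) = (bits m).image σ := by
  have key : ∀ l : List ℕ, bits (l.foldr
      (fun i acc => bif m.testBit i then 2 ^ σ i ||| acc else acc) 0) =
      (l.toFinset.filter (fun i => m.testBit i)).image σ := by
    intro l
    induction l with
    | nil => simp [bits]
    | cons a l ih =>
      rw [List.foldr_cons]
      cases h : m.testBit a
      · rw [cond_false, ih, List.toFinset_cons, Finset.filter_insert, if_neg (by simp [h])]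
      · rw [cond_true, bits_lor, ih, bits_two_pow, List.toFinset_cons, Finset.filter_insert,
          if_pos h, Finset.image_insert, Finset.insert_eq]
  rw [mapMask, key]
  congr 1
  ext i
  simp only [List.toFinset_range, Finset.mem_filter, Finset.mem_range]
  exact ⟨fun h => mem_bits.2 h.2, fun h => ⟨lt_of_mem_bits hm h, mem_bits.1 h⟩⟩

/-! ### Configurations -/

/-- The vertices named by the mask `m` under the naming `ρ`. -/
def named {V : Type*} [DecidableEq V] (ρ : ℕ → V) (m : ℕ) : Finset V := (bits m).image ρ

/-- A list of sets, given by masks, on the names `0, …, order - 1`. -/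
structure Configuration where
  order : ℕ
  masks : List ℕ

/-- The naming `ρ` realizes the configuration `c` in `G`: distinct names have distinct values and
the sets of the configuration are unblocked. -/
structure Realizes {V : Type*} [DecidableEq V] (G : Finset (Finset V)) (c : Configuration)
    (ρ : ℕ → V) : Prop where
  injOn : Set.InjOn ρ {i | i < c.order}
  lt : ∀ m ∈ c.masks, m < 2 ^ c.order
  unblocked : ∀ m ∈ c.masks, Unblocked G (named ρ m)

/-- The set `t` meets no set of the list in exactly one point. -/
def compatible (t : ℕ) (l : List ℕ) : Bool := l.all (fun f => !isPow (t &&& f))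

/-- Complete the mask `t` on `k` names to a `4`-set by new names. -/
def complete (k t : ℕ) : ℕ := t ||| ((2 ^ (4 - popCount k t) - 1) <<< k)

/-- The configurations obtained from `c` by the case distinction whether the set `e` is unblocked,
or else which of the named vertices a blocking hyperedge contains. -/
def children (c : Configuration) (e : ℕ) : List Configuration :=
  ⟨c.order, e :: c.masks⟩ ::
  ((List.range (2 ^ c.order)).filter (fun t =>
    isPow (t &&& e) && Nat.ble (popCount c.order t) 4 && compatible t c.masks)).map
    (fun t => ⟨c.order + (4 - popCount c.order t), complete c.order t :: c.masks⟩)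

section Realizes

variable {V : Type*} [DecidableEq V] {G : Finset (Finset V)} {c : Configuration} {ρ : ℕ → V}

theorem card_named (h : Set.InjOn ρ {i | i < c.order}) {m : ℕ} (hm : m < 2 ^ c.order) :
    (named ρ m).card = (bits m).card :=
  Finset.card_image_of_injOn (h.mono fun _ hi => lt_of_mem_bits hm hi)

theorem card_named' (h : Set.InjOn ρ {i | i < c.order}) {m : ℕ} (hm : m < 2 ^ c.order) :
    (named ρ m).card = popCount c.order m := by
  rw [card_named h hm, popCount_eq hm]

theorem named_inter (h : Set.InjOn ρ {i | i < c.order}) {m n : ℕ} (hm : m < 2 ^ c.order)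
    (hn : n < 2 ^ c.order) : named ρ m ∩ named ρ n = named ρ (m &&& n) := by
  rw [named, named, named, bits_land, Finset.image_inter_of_injOn]
  refine h.mono ?_
  rintro i (hi | hi)
  · exact lt_of_mem_bits hm hi
  · exact lt_of_mem_bits hn hi

theorem land_lt {m n k : ℕ} (hm : m < 2 ^ k) : m &&& n < 2 ^ k :=
  lt_of_le_of_lt Nat.and_le_left hm

theorem card_named_inter (h : Set.InjOn ρ {i | i < c.order}) {m n : ℕ} (hm : m < 2 ^ c.order)
    (hn : n < 2 ^ c.order) : (named ρ m ∩ named ρ n).card = 1 ↔ isPow (m &&& n) = true := by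
  rw [named_inter h hm hn, card_named h (land_lt hm), isPow_iff]

theorem named_congr {ρ' : ℕ → V} {k m : ℕ} (hm : m < 2 ^ k) (h : ∀ i < k, ρ' i = ρ i) :
    named ρ' m = named ρ m :=
  Finset.image_congr (fun _ hi => h _ (lt_of_mem_bits hm hi))

/-- A naming extends to new names for the elements of a further finite set. -/
theorem exists_extension (k : ℕ) (hρ : Set.InjOn ρ {i | i < k}) (A : Finset V)
    (hA : ∀ i < k, ρ i ∉ A) :
    ∃ ρ' : ℕ → V, (∀ i < k, ρ' i = ρ i) ∧ Set.InjOn ρ' {i | i < k + A.card} ∧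
      ((Finset.range (k + A.card)).filter (fun i => k ≤ i)).image ρ' = A := by
  induction A using Finset.induction_on with
  | empty =>
    refine ⟨ρ, fun _ _ => rfl, by simpa using hρ, ?_⟩
    rw [Finset.image_eq_empty, Finset.filter_eq_empty_iff]
    intro i hi
    simpa using hi
  | insert a A ha ih =>
    obtain ⟨ρ', h1, h2, h3⟩ := ih (fun i hi h => hA i hi (Finset.mem_insert_of_mem h))
    have hold : ∀ i < k + A.card, ρ' i ≠ a := by
      intro i hi hia
      by_cases hk : i < k
      · exact hA i hk (by rw [← h1 i hk, hia]; exact Finset.mem_insert_self _ _)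
      · apply ha
        rw [← h3, ← hia]
        exact Finset.mem_image_of_mem _ (by simp; omega)
    refine ⟨Function.update ρ' (k + A.card) a, ?_, ?_, ?_⟩
    · intro i hi
      rw [Function.update_of_ne (by omega), h1 i hi]
    · rw [Finset.card_insert_of_notMem ha]
      intro i hi j hj hij
      simp only [Set.mem_ofPred_eq] at hi hj
      by_cases h4 : i = k + A.card <;> by_cases h5 : j = k + A.card
      · omega
      · rw [h4, Function.update_self, Function.update_of_ne h5] at hij
        exact absurd hij.symm (hold j (by omega))
      · rw [h5, Function.update_self, Function.update_of_ne h4] at hij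
        exact absurd hij (hold i (by omega))
      · rw [Function.update_of_ne h4, Function.update_of_ne h5] at hij
        exact h2 (by simp; omega) (by simp; omega) hij
    · rw [Finset.card_insert_of_notMem ha, ← add_assoc, Finset.range_add_one,
        Finset.filter_insert, if_pos (by omega), Finset.image_insert, Function.update_self]
      congr 1
      refine Eq.trans (Finset.image_congr ?_) h3
      intro i hi
      simp at hi
      exact Function.update_of_ne (by omega) _ _

theorem complete_lt {k t : ℕ} (ht : t < 2 ^ k) :
    complete k t < 2 ^ (k + (4 - popCount k t)) := by
  apply Nat.or_lt_two_pow
  · exact lt_of_lt_of_le ht (Nat.pow_le_pow_right two_pos (by omega))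
  · rw [Nat.shiftLeft_eq, add_comm, pow_add]
    exact Nat.mul_lt_mul_of_pos_right (Nat.sub_lt (by positivity) one_pos) (by positivity)

theorem bits_complete {k t : ℕ} :
    bits (complete k t) = bits t ∪
      (Finset.range (k + (4 - popCount k t))).filter (fun i => k ≤ i) := by
  rw [complete, bits_lor]
  congr 1
  ext i
  simp only [mem_bits, Nat.testBit_shiftLeft, Nat.testBit_two_pow_sub_one, Bool.and_eq_true,
    decide_eq_true_eq, Finset.mem_filter, Finset.mem_range]
  omega

/-- The case distinction behind `children` is exhaustive. -/
theorem Realizes.exists_child (hG : Maximal4 G) (h : Realizes G c ρ) {e : ℕ}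
    (he : e < 2 ^ c.order) :
    ∃ d ∈ children c e, ∃ ρ' : ℕ → V, (∀ i < c.order, ρ' i = ρ i) ∧ Realizes G d ρ' := by
  by_cases hu : Unblocked G (named ρ e)
  · exact ⟨_, List.mem_cons_self, ρ, fun _ _ => rfl, h.injOn,
      List.forall_mem_cons.2 ⟨he, h.lt⟩, List.forall_mem_cons.2 ⟨hu, h.unblocked⟩⟩
  · simp only [Unblocked, not_forall, not_not] at hu
    obtain ⟨g, hg, hge⟩ := hu
    -- `t` is the trace of the blocking hyperedge `g` on the named vertices.
    obtain ⟨t, ht, htb⟩ := exists_bits ((Finset.range c.order).filter (fun i => ρ i ∈ g))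
      (k := c.order) (by simp +contextual)
    have htn : ∀ m < 2 ^ c.order, g ∩ named ρ m = named ρ (t &&& m) := by
      intro m hm
      ext v
      simp only [named, bits_land, htb, Finset.mem_inter, Finset.mem_image, Finset.mem_filter,
        Finset.mem_range]
      constructor
      · rintro ⟨hv, i, hi, rfl⟩
        exact ⟨i, ⟨⟨lt_of_mem_bits hm hi, hv⟩, hi⟩, rfl⟩
      · rintro ⟨i, ⟨⟨_, hv⟩, hi⟩, rfl⟩
        exact ⟨hv, i, hi, rfl⟩
    have htg : named ρ t ⊆ g := by
      have := htn t ht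
      rw [Nat.and_self] at this
      exact this ▸ Finset.inter_subset_left
    have hcard : popCount c.order t + (g \ named ρ t).card = 4 := by
      rw [← card_named' h.injOn ht, add_comm, Finset.card_sdiff_add_card_eq_card htg,
        hG.card_eq g hg]
    have hfr : (g \ named ρ t).card = 4 - popCount c.order t := by omega
    -- The vertices of `g` outside its trace are unnamed; they receive the next free names, as
    -- `complete` prescribes.
    obtain ⟨ρ', h1, h2, h3⟩ := exists_extension c.order h.injOn (g \ named ρ t) (by
      intro i hi hm
      rw [Finset.mem_sdiff] at hm
      apply hm.2
      rw [named, htb]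
      exact Finset.mem_image_of_mem _ (by simp [hi, hm.1]))
    rw [hfr] at h2 h3
    have hg' : named ρ' (complete c.order t) = g := by
      rw [named, bits_complete, Finset.image_union, h3]
      change named ρ' t ∪ _ = _
      rw [named_congr ht h1, Finset.union_sdiff_of_subset htg]
    refine ⟨⟨c.order + (4 - popCount c.order t), complete c.order t :: c.masks⟩, ?_, ρ', h1, h2,
      ?_, ?_⟩
    · refine List.mem_cons_of_mem _ (List.mem_map.2 ⟨t, List.mem_filter.2 ⟨?_, ?_⟩, rfl⟩)
      · exact List.mem_range.2 ht
      · simp only [Bool.and_eq_true, Nat.ble_eq]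
        refine ⟨⟨?_, by omega⟩, ?_⟩
        · rw [htn e he, card_named h.injOn (land_lt ht)] at hge
          exact isPow_iff.2 hge
        -- All listed sets are unblocked, so the hyperedge `g` cannot meet one of them in a single
        -- vertex.
        · rw [compatible, List.all_eq_true]
          intro f hf
          rw [Bool.not_eq_true', Bool.eq_false_iff]
          intro hp
          apply h.unblocked f hf g hg
          rw [htn f (h.lt f hf), card_named h.injOn (land_lt ht)]
          exact isPow_iff.1 hp
    · refine List.forall_mem_cons.2 ⟨complete_lt ht, fun m hm => ?_⟩
      exact lt_of_lt_of_le (h.lt m hm) (Nat.pow_le_pow_right two_pos (by simp))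
    · refine List.forall_mem_cons.2 ⟨?_, fun m hm => ?_⟩
      · rw [hg']
        exact hG.unblocked g hg
      · rw [named_congr (h.lt m hm) h1]
        exact h.unblocked m hm

end Realizes

/-! ### Certificates -/

/-- The `i`-th hexadecimal digit of `x`, not counting the last two. -/
def digit (x i : ℕ) : ℕ := (x >>> (8 + 4 * i)) % 16

/-- Whether the renaming with the given digits embeds `a` into `b`, fixing the name `0` if `fix`
is true. -/
def embeds (fix : Bool) (x : ℕ) (a b : Configuration) : Bool :=
  (!fix || digit x 0 == 0) &&
  (List.range a.order).all (fun i => Nat.blt (digit x i) b.order &&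
    (List.range i).all (fun j => !(digit x i == digit x j))) &&
  a.masks.all (fun m => Nat.blt m (2 ^ a.order) &&
    b.masks.any (fun n => n == mapMask a.order (digit x) m))

/-- A case distinction for a configuration, with a renaming of an earlier configuration into each
case that is not immediate. -/
structure Step where
  order : ℕ
  masks : List ℕ
  split : ℕ
  renamings : List ℕ

/-- Check that each configuration of the list is immediate or contains a renamed configuration of
the table. -/
def checkCases (fix : Bool) (immediate : Configuration → Bool) (table : List Configuration) :
    List Configuration → List ℕ → Bool
  | [], _ => true
  | c :: cs, xs => if immediate c then checkCases fix immediate table cs xs else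
    (table[xs.headD 0 % 256]?).any (fun a => embeds fix (xs.headD 0) a c) &&
      checkCases fix immediate table cs xs.tail

/-- Check a list of steps, each of which may use the table and the earlier steps. -/
def checkSteps (fix : Bool) (immediate : Configuration → Bool) :
    List Configuration → List Step → Bool
  | _, [] => true
  | table, s :: ss => Nat.blt 0 s.order && Nat.blt s.split (2 ^ s.order) &&
      checkCases fix immediate table (children ⟨s.order, s.masks⟩ s.split) s.renamings &&
      checkSteps fix immediate (table ++ [⟨s.order, s.masks⟩]) ss

section Certificates

variable {V : Type*} [DecidableEq V] {G : Finset (Finset V)} {P : (ℕ → V) → Prop} {fix : Bool}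
  {immediate : Configuration → Bool}

/-- Being unblocked is a property of vertex sets, so a realization of `b` restricts, along the
renaming, to a realization of any configuration embedded in `b`. -/
theorem Realizes.of_embeds {a b : Configuration} {x : ℕ} {ρ : ℕ → V}
    (h : Realizes G b ρ) (hx : embeds fix x a b = true) : Realizes G a (ρ ∘ digit x) := by
  simp only [embeds, Bool.and_eq_true, List.all_eq_true, List.mem_range, Nat.blt_eq,
    List.any_eq_true, beq_iff_eq, Bool.not_eq_true', beq_eq_false_iff_ne] at hx
  obtain ⟨⟨-, h1⟩, h2⟩ := hx
  refine ⟨?_, fun m hm => (h2 m hm).1, ?_⟩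
  · intro i hi j hj hij
    have hd : digit x i = digit x j := h.injOn (h1 i hi).1 (h1 j hj).1 hij
    rcases lt_trichotomy i j with hlt | heq | hgt
    · exact absurd hd.symm ((h1 j hj).2 i hlt)
    · exact heq
    · exact absurd hd ((h1 i hi).2 j hgt)
  · intro m hm
    obtain ⟨hlt, n, hn, rfl⟩ := h2 m hm
    have := h.unblocked _ hn
    rwa [named, bits_mapMask _ hlt, Finset.image_image] at this

/-- `hP` says that `P` sees a naming at most through its value at `0`, and not at all if `fix` is
false; this permits renaming and adding names. A missing renaming is read as `0`, which is harmless
because `embeds` verifies whatever is read. -/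
theorem of_checkCases {table : List Configuration}
    (hP : ∀ ρ ρ' : ℕ → V, (fix = true → ρ' 0 = ρ 0) → P ρ' → P ρ)
    (himm : ∀ c ρ, immediate c = true → Realizes G c ρ → P ρ)
    (htable : ∀ c ∈ table, ∀ ρ, Realizes G c ρ → P ρ) :
    ∀ (cs : List Configuration) (xs : List ℕ), checkCases fix immediate table cs xs = true →
      ∀ c ∈ cs, ∀ ρ, Realizes G c ρ → P ρ := by
  intro cs
  induction cs with
  | nil => simp
  | cons d cs ih =>
    intro xs hxs
    rw [checkCases] at hxs
    split at hxs
    · next hd => exact List.forall_mem_cons.2 ⟨fun ρ => himm d ρ hd, ih xs hxs⟩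
    · simp only [Bool.and_eq_true, Option.any_eq_true] at hxs
      obtain ⟨⟨a, ha, h1⟩, h2⟩ := hxs
      refine List.forall_mem_cons.2 ⟨fun ρ hρ => ?_, ih _ h2⟩
      refine hP ρ _ ?_ (htable a (List.mem_of_getElem? ha) _ (hρ.of_embeds h1))
      intro hf
      simp only [embeds, hf, Bool.and_eq_true, Bool.not_true, Bool.false_or, beq_iff_eq] at h1
      exact congrArg ρ h1.1.1

/-- A checked list of steps shows that every realization of one of its configurations has the
property `P`, if this is so for the immediate configurations and for those of the table. -/
theorem of_checkSteps (hG : Maximal4 G)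
    (hP : ∀ ρ ρ' : ℕ → V, (fix = true → ρ' 0 = ρ 0) → P ρ' → P ρ)
    (himm : ∀ c ρ, immediate c = true → Realizes G c ρ → P ρ) :
    ∀ (steps : List Step) (table : List Configuration),
      (∀ c ∈ table, ∀ ρ, Realizes G c ρ → P ρ) → checkSteps fix immediate table steps = true →
      ∀ s ∈ steps, ∀ ρ, Realizes G ⟨s.order, s.masks⟩ ρ → P ρ := by
  intro steps
  induction steps with
  | nil => simp
  | cons s ss ih =>
    intro table htable hcheck
    simp only [checkSteps, Bool.and_eq_true, Nat.blt_eq] at hcheck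
    have hs : ∀ ρ, Realizes G ⟨s.order, s.masks⟩ ρ → P ρ := by
      intro ρ hρ
      obtain ⟨d, hd, ρ', h0, hd'⟩ := hρ.exists_child hG hcheck.1.1.2
      exact hP ρ ρ' (fun _ => h0 0 hcheck.1.1.1) <|
        of_checkCases hP himm htable _ _ hcheck.1.2 d hd ρ' hd'
    refine List.forall_mem_cons.2 ⟨hs, ih _ ?_ hcheck.2⟩
    intro c hc
    rcases List.mem_append.1 hc with hc | hc
    · exact htable c hc
    · rw [List.mem_singleton] at hc
      exact hc ▸ hs

end Certificates

/-! ### Cores -/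

section Cores

variable {V : Type*} [DecidableEq V] {G S : Finset (Finset V)}

theorem unblocked_pair_iff {x y : V} (hxy : x ≠ y) :
    Unblocked G {x, y} ↔ ∀ f ∈ G, (x ∈ f ↔ y ∈ f) := by
  refine forall₂_congr fun f _ => ?_
  by_cases hx : x ∈ f <;> by_cases hy : y ∈ f <;>
    simp [hx, hy, Finset.inter_insert_of_mem, Finset.inter_insert_of_notMem, hxy]

/-- Some other vertex lies in the same hyperedges as `x`. -/
def HasTwin (G : Finset (Finset V)) (x : V) : Prop := ∃ y, y ≠ x ∧ Unblocked G {x, y}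

theorem HasTwin.exists_iff {x : V} (h : HasTwin G x) : ∃ y, y ≠ x ∧ ∀ f ∈ G, (x ∈ f ↔ y ∈ f) := by
  obtain ⟨y, hy, h⟩ := h
  exact ⟨y, hy, (unblocked_pair_iff hy.symm).1 h⟩

theorem HasTwin.of_forall_iff {x y : V} (hy : y ≠ x) (h : ∀ f ∈ G, (x ∈ f ↔ y ∈ f)) :
    HasTwin G x :=
  ⟨y, hy, (unblocked_pair_iff hy.symm).2 h⟩

/-- A core is a set `U` of vertices that is covered by hyperedges inside `U`, in which any two
vertices that are not twins are separated by a hyperedge inside `U`, and whose vertices without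
twins have distinct representatives among the hyperedges inside `U` that are not in `S`. -/
structure IsCore (G S : Finset (Finset V)) (U : Finset V) : Prop where
  covered : ∀ x ∈ U, ∃ f ∈ G, f ⊆ U ∧ x ∈ f
  separated : ∀ x ∈ U, ∀ y ∈ U, x ≠ y →
    Unblocked G {x, y} ∨ ∃ f ∈ G, f ⊆ U ∧ ¬ (x ∈ f ↔ y ∈ f)
  matched : ∃ φ : V → Finset V, Set.InjOn φ {x | x ∈ U ∧ ¬ HasTwin G x} ∧
    ∀ x ∈ U, ¬ HasTwin G x → φ x ∈ G ∧ φ x ∉ S ∧ φ x ⊆ U ∧ x ∈ φ x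

theorem isCore_empty : IsCore G S ∅ :=
  ⟨by simp, by simp, ⟨fun _ => ∅, by simp [Set.InjOn], by simp⟩⟩

/-- Hyperedges inside `U` miss `c`. Hence those covering `U` separate its vertices from `c`, and
`f`, which contains `c`, is not yet used as a representative. -/
theorem IsCore.insert_vertex {U f : Finset V} (h : IsCore G S U) {c : V} (hf : f ∈ G) (hS : f ∉ S)
    (hc : c ∈ f) (hcU : c ∉ U) (hfU : f ⊆ insert c U) : IsCore G S (insert c U) := by
  refine ⟨?_, ?_, ?_⟩
  · intro x hx
    rcases Finset.mem_insert.1 hx with rfl | hx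
    · exact ⟨f, hf, hfU, hc⟩
    · obtain ⟨g, hg, hgU, hxg⟩ := h.covered x hx
      exact ⟨g, hg, hgU.trans (Finset.subset_insert _ _), hxg⟩
  · intro x hx y hy hxy
    rcases Finset.mem_insert.1 hx with rfl | hx' <;> rcases Finset.mem_insert.1 hy with rfl | hy'
    · exact absurd rfl hxy
    · obtain ⟨g, hg, hgU, hyg⟩ := h.covered y hy'
      exact Or.inr ⟨g, hg, hgU.trans (Finset.subset_insert _ _), fun hi => hcU (hgU (hi.2 hyg))⟩
    · obtain ⟨g, hg, hgU, hxg⟩ := h.covered x hx'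
      exact Or.inr ⟨g, hg, hgU.trans (Finset.subset_insert _ _), fun hi => hcU (hgU (hi.1 hxg))⟩
    · rcases h.separated x hx' y hy' hxy with ht | ⟨g, hg, hgU, hgxy⟩
      · exact Or.inl ht
      · exact Or.inr ⟨g, hg, hgU.trans (Finset.subset_insert _ _), hgxy⟩
  · obtain ⟨φ, hinj, hφ⟩ := h.matched
    have hne : ∀ x ∈ U, ¬ HasTwin G x → φ x ≠ f := by
      intro x hx hxt hxf
      exact hcU ((hφ x hx hxt).2.2.1 (hxf ▸ hc))
    refine ⟨Function.update φ c f, ?_, ?_⟩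
    · rintro x ⟨hx, hxt⟩ y ⟨hy, hyt⟩ hxy
      rw [Finset.mem_insert] at hx hy
      by_cases h1 : x = c <;> by_cases h2 : y = c
      · rw [h1, h2]
      · rw [h1, Function.update_self, Function.update_of_ne h2] at hxy
        exact absurd hxy.symm (hne y (hy.resolve_left h2) hyt)
      · rw [h2, Function.update_self, Function.update_of_ne h1] at hxy
        exact absurd hxy (hne x (hx.resolve_left h1) hxt)
      · rw [Function.update_of_ne h1, Function.update_of_ne h2] at hxy
        exact hinj ⟨hx.resolve_left h1, hxt⟩ ⟨hy.resolve_left h2, hyt⟩ hxy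
    · intro x hx hxt
      by_cases h1 : x = c
      · subst h1
        rw [Function.update_self]
        exact ⟨hf, hS, hfU, hc⟩
      · rw [Function.update_of_ne h1]
        obtain ⟨ha, hb, hd, he⟩ := hφ x ((Finset.mem_insert.1 hx).resolve_left h1) hxt
        exact ⟨ha, hb, hd.trans (Finset.subset_insert _ _), he⟩

/-- A hyperedge through a vertex of a core that has no twin meets the core in at least three
vertices. -/
theorem IsCore.three_le (hG : Maximal4 G) {U f : Finset V} (h : IsCore G S U) (hf : f ∈ G)
    {x : V} (hx : x ∈ U) (hxt : ¬ HasTwin G x) (hxf : x ∈ f) : 3 ≤ (f ∩ U).card := by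
  have hmem : x ∈ f ∩ U := Finset.mem_inter.2 ⟨hxf, hx⟩
  have key : ∀ g ∈ G, g ⊆ U → (g ∩ f).card = 1 → False := fun g hg _ h1 => hG.unblocked f hf g hg h1
  by_contra hlt
  have hpos : 0 < (f ∩ U).card := Finset.card_pos.2 ⟨x, hmem⟩
  obtain h1 | h2 : (f ∩ U).card = 1 ∨ (f ∩ U).card = 2 := by omega
  -- If `f` meets the core in `x` alone, so does it meet any hyperedge inside the core that covers
  -- `x`.
  · obtain ⟨g, hg, hgU, hxg⟩ := h.covered x hx
    apply key g hg hgU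
    refine le_antisymm ?_ (Finset.card_pos.2 ⟨x, Finset.mem_inter.2 ⟨hxg, hxf⟩⟩)
    rw [← h1, Finset.inter_comm g]
    exact Finset.card_le_card (Finset.inter_subset_inter_left hgU)
  · obtain ⟨y, hy, hfU⟩ : ∃ y, y ≠ x ∧ f ∩ U = {x, y} := by
      obtain ⟨a, b, hab, he⟩ := Finset.card_eq_two.1 h2
      rw [he, Finset.mem_insert, Finset.mem_singleton] at hmem
      rcases hmem with rfl | rfl
      · exact ⟨b, hab.symm, he⟩
      · exact ⟨a, hab, by rw [he, Finset.pair_comm]⟩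
    have hyU : y ∈ U := (Finset.mem_inter.1 (hfU ▸ (by simp : y ∈ ({x, y} : Finset V)))).2
    -- As `x` has no twin, some hyperedge `g` inside `U` contains exactly one of `x` and `y`; since
    -- `f ∩ U = {x, y}`, it meets `f` in one vertex.
    rcases h.separated x hx y hyU hy.symm with ht | ⟨g, hg, hgU, hgxy⟩
    · exact hxt ⟨y, hy, ht⟩
    · apply key g hg hgU
      have : g ∩ f = g ∩ {x, y} := by
        rw [← hfU, ← Finset.inter_assoc]
        exact (Finset.inter_eq_left.2 (Finset.inter_subset_left.trans hgU)).symm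
      rw [this]
      by_contra hne
      -- The criterion for pairs is applied to the family consisting of `g` alone.
      have hu : Unblocked {g} {x, y} := by simpa [Unblocked] using hne
      exact hgxy ((unblocked_pair_iff hy.symm).1 hu g (Finset.mem_singleton_self g))

/-- A core extends to one that contains every hyperedge through one of its vertices that has no
twin. -/
theorem IsCore.exists_closed [Fintype V] (hG : Maximal4 G) {U : Finset V} (h : IsCore G S U)
    (hS : ∀ g ∈ S, g ⊆ U) : ∃ W, U ⊆ W ∧ IsCore G S W ∧
      ∀ f ∈ G, ∀ x ∈ f, x ∈ W → ¬ HasTwin G x → f ⊆ W := by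
  classical
  -- A core of maximum size is closed: a hyperedge violating this would enlarge it by one vertex.
  obtain ⟨W, hW, hmax⟩ := Finset.exists_max_image
    (Finset.univ.filter (fun W => U ⊆ W ∧ IsCore G S W)) Finset.card ⟨U, by simp [h]⟩
  simp only [Finset.mem_filter, Finset.mem_univ, true_and] at hW hmax
  refine ⟨W, hW.1, hW.2, fun f hf x hxf hxW hxt => ?_⟩
  by_contra hfW
  obtain ⟨c, hcf, hcW⟩ := Finset.not_subset.1 hfW
  have h3 := hW.2.three_le hG hf hxW hxt hxf
  -- At least three of the four vertices of `f` lie in `W`, so `c` is the only one outside.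
  have hsub : f ⊆ insert c W := by
    intro y hy
    by_contra hyn
    rw [Finset.mem_insert, not_or] at hyn
    have h2 : ({y, c} : Finset V) ⊆ f \ W := by
      intro z hz
      rw [Finset.mem_insert, Finset.mem_singleton] at hz
      rcases hz with rfl | rfl <;> simp [*]
    have := Finset.card_le_card h2
    rw [Finset.card_pair hyn.1] at this
    have h4 := Finset.card_inter_add_card_sdiff f W
    rw [hG.card_eq f hf] at h4
    omega
  have := hmax _ ⟨hW.1.trans (Finset.subset_insert c W),
    hW.2.insert_vertex hf (fun hfS => hfW ((hS f hfS).trans hW.1)) hcf hcW hsub⟩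
  rw [Finset.card_insert_of_notMem hcW] at this
  omega

/-- If every covered vertex without twins lies in a core, then these vertices have distinct
representatives among the hyperedges, even outside a set `S` of spare hyperedges of a core. -/
theorem exists_matching [Fintype V] (hG : Maximal4 G)
    (hcore : ∀ x, (∃ f ∈ G, x ∈ f) → ¬ HasTwin G x → ∃ U, IsCore G ∅ U ∧ x ∈ U)
    {U₀ : Finset V} (h₀ : IsCore G S U₀) (hS : ∀ g ∈ S, g ∈ G ∧ g ⊆ U₀ ∧ ∃ x ∈ g, ¬ HasTwin G x) :
    ∃ φ : V → Finset V, Set.InjOn φ {x | (∃ f ∈ G, x ∈ f) ∧ ¬ HasTwin G x} ∧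
      ∀ x, (∃ f ∈ G, x ∈ f) → ¬ HasTwin G x → φ x ∈ G ∧ φ x ∉ S ∧ x ∈ φ x := by
  classical
  -- A good set consists of vertices without twins, is closed under hyperedges up to vertices with
  -- twins, and has its own representatives. It contains the twinless part of `U₀` from the
  -- beginning, so later representatives cannot use the spare hyperedges in `S`.
  let Good : Finset V → Prop := fun Z => (∀ x ∈ U₀, ¬ HasTwin G x → x ∈ Z) ∧
    (∀ x ∈ Z, ¬ HasTwin G x) ∧
    (∀ f ∈ G, ∀ x ∈ f, x ∈ Z → ∀ y ∈ f, ¬ HasTwin G y → y ∈ Z) ∧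
    ∃ φ : V → Finset V, Set.InjOn φ Z ∧ ∀ x ∈ Z, φ x ∈ G ∧ φ x ∉ S ∧ x ∈ φ x
  have hstart : ∃ Z, Good Z := by
    obtain ⟨W, hUW, hW, hclosed⟩ := h₀.exists_closed hG (fun g hg => (hS g hg).2.1)
    obtain ⟨φ, hinj, hφ⟩ := hW.matched
    refine ⟨W.filter (fun x => ¬ HasTwin G x), ?_, ?_, ?_, φ, ?_, ?_⟩
    · exact fun x hx hxt => Finset.mem_filter.2 ⟨hUW hx, hxt⟩
    · exact fun x hx => (Finset.mem_filter.1 hx).2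
    · intro f hf x hxf hxZ y hyf hyt
      rw [Finset.mem_filter] at hxZ
      exact Finset.mem_filter.2 ⟨hclosed f hf x hxf hxZ.1 hxZ.2 hyf, hyt⟩
    · exact hinj.mono (fun x hx => Finset.mem_filter.1 hx)
    · intro x hx
      rw [Finset.mem_filter] at hx
      have := hφ x hx.1 hx.2
      exact ⟨this.1, this.2.1, this.2.2.2⟩
  obtain ⟨Z, hZ, hmax⟩ := Finset.exists_max_image (Finset.univ.filter Good) Finset.card
    (by obtain ⟨Z, hZ⟩ := hstart; exact ⟨Z, by simp [hZ]⟩)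
  simp only [Finset.mem_filter, Finset.mem_univ, true_and] at hZ hmax
  obtain ⟨hZU, hZt, hZclosed, φ, hinj, hφ⟩ := id hZ
  have hall : ∀ x, (∃ f ∈ G, x ∈ f) → ¬ HasTwin G x → x ∈ Z := by
    intro u huf hut
    by_contra huZ
    obtain ⟨U, hU, huU⟩ := hcore u huf hut
    obtain ⟨W, hUW, hW, hclosed⟩ := hU.exists_closed hG (by simp)
    obtain ⟨ψ, hψinj, hψ⟩ := hW.matched
    -- A representative of a new vertex misses `Z`, since closedness would otherwise put that vertex
    -- into `Z`. It therefore differs from every old representative.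
    have hψZ : ∀ x ∈ W, ¬ HasTwin G x → x ∉ Z → ∀ z ∈ Z, z ∉ ψ x := by
      intro x hxW hxt hxZ z hz hzx
      have := hψ x hxW hxt
      exact hxZ (hZclosed _ this.1 z hzx hz x this.2.2.2 hxt)
    have hgood : Good (Z ∪ W.filter (fun x => ¬ HasTwin G x)) := by
      refine ⟨fun x hx hxt => Finset.mem_union_left _ (hZU x hx hxt), ?_, ?_,
        fun x => if x ∈ Z then φ x else ψ x, ?_, ?_⟩
      · intro x hx
        rcases Finset.mem_union.1 hx with hx | hx
        · exact hZt x hx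
        · exact (Finset.mem_filter.1 hx).2
      · intro f hf x hxf hx y hyf hyt
        rcases Finset.mem_union.1 hx with hx | hx
        · exact Finset.mem_union_left _ (hZclosed f hf x hxf hx y hyf hyt)
        · rw [Finset.mem_filter] at hx
          exact Finset.mem_union_right _
            (Finset.mem_filter.2 ⟨hclosed f hf x hxf hx.1 hx.2 hyf, hyt⟩)
      · intro x hx y hy hxy
        rw [Finset.mem_coe, Finset.mem_union, Finset.mem_filter] at hx hy
        by_cases h1 : x ∈ Z <;> by_cases h2 : y ∈ Z <;> simp only [h1, h2, if_true, if_false] at hxy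
        · exact hinj h1 h2 hxy
        · obtain ⟨hyW, hyt⟩ := hy.resolve_left h2
          exact absurd (hxy ▸ (hφ x h1).2.2) (hψZ y hyW hyt h2 x h1)
        · obtain ⟨hxW, hxt⟩ := hx.resolve_left h1
          exact absurd (hxy ▸ (hφ y h2).2.2) (hψZ x hxW hxt h1 y h2)
        · exact hψinj (hx.resolve_left h1) (hy.resolve_left h2) hxy
      · intro x hx
        rw [Finset.mem_union, Finset.mem_filter] at hx
        by_cases h1 : x ∈ Z <;> simp only [h1, if_true, if_false]
        · exact hφ x h1
        · obtain ⟨hxW, hxt⟩ := hx.resolve_left h1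
          have := hψ x hxW hxt
          refine ⟨this.1, fun hxS => ?_, this.2.2.2⟩
          -- A spare hyperedge contains a twinless vertex of `U₀`, which lies in `Z`, whereas `ψ x`
          -- misses `Z`.
          obtain ⟨-, hsub, z, hz, hzt⟩ := hS _ hxS
          exact hψZ x hxW hxt h1 z (hZU z (hsub hz) hzt) hz
    have hle := hmax _ hgood
    have hlt : Z.card < (Z ∪ W.filter (fun x => ¬ HasTwin G x)).card := by
      apply Finset.card_lt_card
      refine ⟨Finset.subset_union_left, fun hsub => huZ (hsub ?_)⟩
      exact Finset.mem_union_right _ (Finset.mem_filter.2 ⟨hUW huU, hut⟩)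
    omega
  exact ⟨φ, fun x hx y hy => hinj (hall x hx.1 hx.2) (hall y hy.1 hy.2),
    fun x hx hxt => hφ x (hall x hx hxt)⟩

end Cores

/-! ### Finding cores -/

/-- Greedy search for distinct representatives: each name of the list lies in its representative. -/
def hasRepresentatives : List ℕ → List ℕ → Bool
  | [], _ => true
  | i :: is, l => l.any (fun e => e.testBit i && hasRepresentatives is (l.erase e))

/-- Distinctness comes from erasing each chosen set. Since `List.erase` removes a single copy, the
list must be free of repetitions. -/
theorem exists_representatives : ∀ (is l : List ℕ), hasRepresentatives is l = true → is.Nodup →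
    l.Nodup → ∃ φ : ℕ → ℕ, (∀ i ∈ is, φ i ∈ l ∧ (φ i).testBit i = true) ∧
      ∀ i ∈ is, ∀ j ∈ is, φ i = φ j → i = j := by
  intro is
  induction is with
  | nil => exact fun l _ _ _ => ⟨fun _ => 0, by simp, by simp⟩
  | cons a is ih =>
    intro l h hnd hl
    simp only [hasRepresentatives, List.any_eq_true, Bool.and_eq_true] at h
    obtain ⟨e, he, hea, h⟩ := h
    rw [List.nodup_cons] at hnd
    obtain ⟨φ, h1, h2⟩ := ih _ h hnd.2 (hl.erase e)
    have hne : ∀ i ∈ is, i ≠ a := fun i hi hia => hnd.1 (hia ▸ hi)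
    have hφe : ∀ i ∈ is, φ i ≠ e := fun i hi hie =>
      (List.Nodup.mem_erase_iff hl).1 (h1 i hi).1 |>.1 hie
    refine ⟨Function.update φ a e, ?_, ?_⟩
    · refine List.forall_mem_cons.2 ⟨?_, fun i hi => ?_⟩
      · rw [Function.update_self]
        exact ⟨he, hea⟩
      · rw [Function.update_of_ne (hne i hi)]
        exact ⟨List.mem_of_mem_erase (h1 i hi).1, (h1 i hi).2⟩
    · refine List.forall_mem_cons.2 ⟨List.forall_mem_cons.2 ⟨fun _ => rfl, fun j hj hij => ?_⟩,
        fun i hi => List.forall_mem_cons.2 ⟨fun hij => ?_, fun j hj hij => ?_⟩⟩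
      · rw [Function.update_self, Function.update_of_ne (hne j hj)] at hij
        exact absurd hij.symm (hφe j hj)
      · rw [Function.update_self, Function.update_of_ne (hne i hi)] at hij
        exact absurd hij (hφe i hi)
      · rw [Function.update_of_ne (hne i hi), Function.update_of_ne (hne j hj)] at hij
        exact h2 i hi j hj hij

/-- The sets of size four in a configuration. -/
def quadruples (c : Configuration) : List ℕ :=
  c.masks.filter (fun m => Nat.beq (popCount c.order m) 4)

/-- The sets of size two in a configuration. -/
def pairs (c : Configuration) : List ℕ :=
  c.masks.filter (fun m => Nat.beq (popCount c.order m) 2)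

/-- Whether the realizations of `c` are cores. -/
def checkCore (c : Configuration) : Bool :=
  Nat.blt 0 c.order && decide (quadruples c).Nodup &&
  (List.range c.order).all (fun i => (quadruples c).any (fun f => f.testBit i) &&
    (List.range i).all (fun j => (pairs c).any (fun p => p == 2 ^ i ||| 2 ^ j) ||
      (quadruples c).any (fun f => f.testBit i != f.testBit j))) &&
  hasRepresentatives
    ((List.range c.order).filter (fun i => (pairs c).all (fun p => !p.testBit i))) (quadruples c)

/-- Whether the configuration `c` states that the vertex named `0` has a twin. -/
def hasTwinZero (c : Configuration) : Bool := (pairs c).any (fun p => p.testBit 0)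

section FindingCores

variable {V : Type*} [DecidableEq V] {G : Finset (Finset V)} {c : Configuration} {ρ : ℕ → V}

/-- Maximality turns an unblocked `4`-set into a hyperedge; this is how configurations, which record
only unblocked sets, yield hyperedges. -/
theorem Realizes.mem_of_quadruples (hG : Maximal4 G) (h : Realizes G c ρ) {m : ℕ}
    (hm : m ∈ quadruples c) : m < 2 ^ c.order ∧ named ρ m ∈ G := by
  rw [quadruples, List.mem_filter, Nat.beq_eq] at hm
  refine ⟨h.lt m hm.1, hG.mem _ ?_ (h.unblocked m hm.1)⟩
  rw [card_named' h.injOn (h.lt m hm.1), hm.2]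

theorem mem_named_iff (h : Set.InjOn ρ {i | i < c.order}) {m i : ℕ} (hm : m < 2 ^ c.order)
    (hi : i < c.order) : ρ i ∈ named ρ m ↔ m.testBit i = true := by
  rw [← mem_bits, named, Finset.mem_image]
  constructor
  · rintro ⟨j, hj, hji⟩
    exact h (lt_of_mem_bits hm hj) hi hji ▸ hj
  · exact fun hi => ⟨i, hi, rfl⟩

theorem named_injOn (h : Set.InjOn ρ {i | i < c.order}) :
    Set.InjOn (named ρ) {m | m < 2 ^ c.order} := by
  have key : ∀ a b : ℕ, a < 2 ^ c.order → b < 2 ^ c.order → named ρ a = named ρ b →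
      bits a ⊆ bits b := by
    intro a b ha hb hab k hk
    have hk' := lt_of_mem_bits ha hk
    rw [mem_bits] at hk ⊢
    rw [← mem_named_iff h ha hk'] at hk
    rwa [← mem_named_iff h hb hk', ← hab]
  exact fun a ha b hb hab =>
    bits_injective (Finset.Subset.antisymm (key a b ha hb hab) (key b a hb ha hab.symm))

theorem Realizes.hasTwin (h : Realizes G c ρ) {p i : ℕ} (hp : p ∈ pairs c)
    (hi : p.testBit i = true) : HasTwin G (ρ i) := by
  rw [pairs, List.mem_filter, Nat.beq_eq] at hp
  have hlt := h.lt p hp.1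
  have hcard := popCount_eq hlt
  rw [hp.2] at hcard
  obtain ⟨a, b, hab, he⟩ := Finset.card_eq_two.1 hcard.symm
  have hu := h.unblocked p hp.1
  have ha : a ∈ bits p := by rw [he]; simp
  have hb : b ∈ bits p := by rw [he]; simp
  have hne : ρ a ≠ ρ b := fun hρ => hab (h.injOn (lt_of_mem_bits hlt ha) (lt_of_mem_bits hlt hb) hρ)
  rw [named, he, Finset.image_insert, Finset.image_singleton] at hu
  rw [← mem_bits, he, Finset.mem_insert, Finset.mem_singleton] at hi
  rcases hi with rfl | rfl
  · exact ⟨_, hne.symm, hu⟩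
  · exact ⟨_, hne, Finset.pair_comm (ρ a) (ρ i) ▸ hu⟩

/-- The conditions on a core are tested with the listed `4`-sets as the only known hyperedges. A
name occurring in a listed pair has a twin and needs no representative. -/
theorem Realizes.isCore (hG : Maximal4 G) (h : Realizes G c ρ) (hc : checkCore c = true) :
    ∃ U, IsCore G ∅ U ∧ ρ 0 ∈ U := by
  simp only [checkCore, Bool.and_eq_true, Nat.blt_eq, decide_eq_true_eq, List.all_eq_true,
    List.mem_range, List.any_eq_true, Bool.or_eq_true, beq_iff_eq, bne_iff_ne] at hc
  obtain ⟨⟨⟨h0, hnd⟩, hsep⟩, hrep⟩ := hc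
  set U := (Finset.range c.order).image ρ with hU
  have hsub : ∀ m ∈ quadruples c, named ρ m ⊆ U := fun m hm =>
    Finset.image_subset_image fun i hi =>
      Finset.mem_range.2 (lt_of_mem_bits (h.mem_of_quadruples hG hm).1 hi)
  have hsep' : ∀ i < c.order, ∀ j < i, Unblocked G {ρ i, ρ j} ∨
      ∃ f ∈ G, f ⊆ U ∧ ¬ (ρ i ∈ f ↔ ρ j ∈ f) := by
    intro i hi j hj
    rcases (hsep i hi).2 j hj with ⟨p, hp, rfl⟩ | ⟨f, hf, hne⟩
    · left
      have := h.unblocked _ (List.mem_filter.1 hp).1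
      rwa [named, bits_lor, bits_two_pow, bits_two_pow, Finset.image_union,
        Finset.image_singleton, Finset.image_singleton] at this
    · right
      have hf' := h.mem_of_quadruples hG hf
      refine ⟨_, hf'.2, hsub f hf, ?_⟩
      rw [mem_named_iff h.injOn hf'.1 hi, mem_named_iff h.injOn hf'.1 (hj.trans hi)]
      exact fun hiff => hne (Bool.eq_iff_iff.2 hiff)
  refine ⟨U, ⟨?_, ?_, ?_⟩, Finset.mem_image_of_mem _ (Finset.mem_range.2 h0)⟩
  · intro x hx
    obtain ⟨i, hi, rfl⟩ := Finset.mem_image.1 hx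
    rw [Finset.mem_range] at hi
    obtain ⟨f, hf, hfi⟩ := (hsep i hi).1
    have hf' := h.mem_of_quadruples hG hf
    exact ⟨_, hf'.2, hsub f hf, (mem_named_iff h.injOn hf'.1 hi).2 hfi⟩
  · intro x hx y hy hxy
    obtain ⟨i, hi, rfl⟩ := Finset.mem_image.1 hx
    obtain ⟨j, hj, rfl⟩ := Finset.mem_image.1 hy
    rw [Finset.mem_range] at hi hj
    rcases lt_trichotomy i j with hlt | heq | hgt
    · rcases hsep' j hj i hlt with ht | ⟨f, hf, hfU, hne⟩
      · exact Or.inl (Finset.pair_comm (ρ j) (ρ i) ▸ ht)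
      · exact Or.inr ⟨f, hf, hfU, fun hiff => hne hiff.symm⟩
    · exact absurd (congrArg ρ heq) hxy
    · exact hsep' i hi j hgt
  · obtain ⟨φ, h1, h2⟩ := exists_representatives _ _ hrep (List.nodup_range.filter _) hnd
    have hmem : ∀ x ∈ U, ¬ HasTwin G x → ∃ i, i < c.order ∧ ρ i = x ∧
        i ∈ (List.range c.order).filter (fun i => (pairs c).all (fun p => !p.testBit i)) := by
      intro x hx hxt
      obtain ⟨i, hi, rfl⟩ := Finset.mem_image.1 hx
      refine ⟨i, Finset.mem_range.1 hi, rfl,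
        List.mem_filter.2 ⟨List.mem_range.2 (Finset.mem_range.1 hi), ?_⟩⟩
      rw [List.all_eq_true]
      intro p hp
      rw [Bool.not_eq_true', Bool.eq_false_iff]
      exact fun hpi => hxt (h.hasTwin hp hpi)
    -- Representatives are found for names; inverting `ρ` on the names in use transfers them to
    -- vertices.
    have hinv : ∀ i < c.order, Function.invFunOn ρ {i | i < c.order} (ρ i) = i := fun i hi =>
      h.injOn.leftInvOn_invFunOn hi
    refine ⟨fun x => named ρ (φ (Function.invFunOn ρ {i | i < c.order} x)), ?_, ?_⟩
    · rintro x ⟨hx, hxt⟩ y ⟨hy, hyt⟩ hxy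
      obtain ⟨i, hi, rfl, hi'⟩ := hmem x hx hxt
      obtain ⟨j, hj, rfl, hj'⟩ := hmem y hy hyt
      simp only [hinv i hi, hinv j hj] at hxy
      congr 1
      apply h2 i hi' j hj'
      have hia := (h.mem_of_quadruples hG (h1 i hi').1).1
      have hja := (h.mem_of_quadruples hG (h1 j hj').1).1
      exact named_injOn h.injOn hia hja hxy
    · intro x hx hxt
      obtain ⟨i, hi, rfl, hi'⟩ := hmem x hx hxt
      have hm := h.mem_of_quadruples hG (h1 i hi').1
      simp only [hinv i hi]
      exact ⟨hm.2, Finset.notMem_empty _, hsub _ (h1 i hi').1,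
        (mem_named_iff h.injOn hm.1 hi).2 (h1 i hi').2⟩

end FindingCores

/-! ### The certificates

The following tables were found by computer search. A digit string `0x…` in a step renames the names
of an earlier configuration (its number is given by the last two digits) into the names of a case. -/

/-- Configurations whose realizations are cores. -/
def coreConfigurations : List Configuration :=
  [
   ⟨5, [15, 6, 23, 30]⟩, ⟨5, [15, 27, 30, 23, 29]⟩, ⟨6, [15, 27, 30, 39, 45, 43]⟩, ⟨6, [15, 27,
   30, 39, 45, 51]⟩, ⟨7, [15, 27, 30, 106, 39, 45, 77]⟩, ⟨7, [15, 27, 30, 39, 45, 85, 78]⟩, ⟨7,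
   [15, 27, 30, 106, 39, 83, 51]⟩, ⟨7, [15, 27, 30, 106, 39, 83, 77]⟩, ⟨7, [15, 27, 30, 106, 39,
   83, 78]⟩, ⟨7, [15, 27, 30, 106, 39, 86, 77]⟩, ⟨7, [15, 27, 30, 106, 39, 86, 54]⟩, ⟨7, [15, 27,
   30, 106, 39, 86, 75]⟩, ⟨7, [15, 27, 30, 106, 54, 60, 90]⟩, ⟨7, [15, 27, 30, 106, 54, 60, 92]⟩,
   ⟨6, [15, 27, 30, 54, 60, 43]⟩, ⟨7, [15, 27, 30, 54, 60, 90, 85]⟩, ⟨7, [15, 27, 99, 23, 45, 85,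
   51]⟩, ⟨7, [15, 27, 99, 23, 45, 85, 77]⟩, ⟨7, [15, 27, 99, 23, 45, 85, 78]⟩, ⟨7, [15, 27, 99,
   23, 46, 86, 90]⟩, ⟨7, [15, 27, 99, 23, 46, 86, 51]⟩, ⟨7, [15, 27, 99, 23, 46, 86, 78]⟩, ⟨7,
   [15, 27, 99, 105, 53, 85, 39]⟩, ⟨7, [15, 27, 99, 106, 54, 86, 39]⟩, ⟨7, [15, 27, 99, 106, 54,
   86, 90]⟩, ⟨8, [15, 27, 99, 169, 43, 53, 89, 147]⟩, ⟨8, [15, 27, 99, 169, 43, 53, 89, 202]⟩, ⟨8,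
   [15, 27, 99, 169, 86, 53, 46, 156]⟩, ⟨8, [15, 27, 99, 169, 86, 53, 46, 202]⟩, ⟨7, [15, 27, 99,
   86, 53, 89, 51]⟩, ⟨7, [15, 27, 99, 86, 53, 89, 77]⟩, ⟨8, [15, 27, 99, 169, 86, 53, 89, 156]⟩,
   ⟨8, [15, 27, 99, 169, 86, 53, 147, 202]⟩, ⟨8, [15, 27, 99, 169, 86, 75, 135, 39]⟩, ⟨8, [15, 27,
   99, 169, 86, 75, 135, 202]⟩, ⟨7, [27, 45, 120, 99, 85, 78, 54]⟩, ⟨8, [15, 27, 99, 170, 43, 54,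
   147, 90]⟩, ⟨8, [15, 27, 99, 170, 85, 45, 156, 54]⟩, ⟨7, [15, 27, 99, 85, 90, 54, 51]⟩, ⟨7, [15,
   27, 99, 85, 90, 54, 78]⟩, ⟨8, [15, 27, 99, 170, 85, 90, 54, 156]⟩, ⟨8, [15, 27, 99, 170, 156,
   46, 90, 54]⟩, ⟨8, [15, 27, 99, 170, 156, 46, 90, 139]⟩, ⟨8, [15, 27, 99, 170, 156, 46, 90,
   202]⟩, ⟨8, [15, 27, 99, 170, 156, 46, 202, 58]⟩, ⟨8, [15, 27, 99, 170, 156, 46, 202, 135]⟩, ⟨7,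
   [15, 27, 106, 92, 83, 71, 54]⟩, ⟨8, [15, 27, 99, 170, 156, 147, 135, 202]⟩, ⟨7, [27, 46, 120,
   99, 86, 78, 54]⟩, ⟨7, [15, 51, 60, 30, 102, 90, 106]⟩, ⟨7, [15, 51, 60, 30, 102, 90, 85]⟩, ⟨7,
   [15, 51, 60, 30, 102, 90, 46]⟩, ⟨7, [15, 51, 60, 30, 102, 90, 58]⟩, ⟨7, [15, 51, 60, 30, 102,
   58, 106]⟩, ⟨7, [15, 51, 60, 30, 58, 106, 89]⟩, ⟨8, [15, 51, 60, 30, 102, 166, 204, 86]⟩, ⟨8,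
   [15, 51, 60, 86, 204, 150, 195, 166]⟩, ⟨6, [15, 58, 54, 60, 48]⟩, ⟨6, [15, 58, 54, 60, 30,
   46]⟩, ⟨7, [15, 58, 54, 60, 86, 90, 92]⟩, ⟨8, [15, 58, 54, 60, 86, 240, 166, 108]⟩, ⟨8, [15, 58,
   54, 60, 86, 240, 166, 102]⟩, ⟨8, [15, 58, 86, 202, 166, 30, 46, 78]⟩, ⟨8, [15, 58, 86, 202,
   166, 240, 102, 150]⟩, ⟨8, [15, 58, 86, 202, 166, 240, 156, 108]⟩]

/-- Case distinctions leading from a single hyperedge to a core. -/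
def coreSteps : List Step :=
  [
   ⟨5, [15, 6, 23], 30, [0x4321000]⟩, ⟨5, [15, 6, 30], 23, [0x4321041]⟩, ⟨4, [15, 6], 9,
   [0x4321041, 0x4321042]⟩, ⟨5, [15, 27, 30, 23], 29, [0x4321001]⟩, ⟨8, [15, 27, 30, 106, 39, 45,
   149], 51, [0x54321003, 0x654321004, 0x754321005]⟩, ⟨7, [15, 27, 30, 106, 39, 45], 43,
   [0x54321002, 0x7654321045]⟩, ⟨7, [15, 27, 30, 106, 39, 83], 51, [0x654321006, 0x654321007,
   0x654321008]⟩, ⟨7, [15, 27, 30, 106, 39, 86], 54, [0x65432100a, 0x65432100b, 0x654321009]⟩, ⟨7,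
   [15, 27, 30, 106, 39], 45, [0x654321046, 0x654321047, 0x654321048]⟩, ⟨8, [15, 27, 30, 106, 54,
   60, 154], 43, [0x5432100e, 0x65412300d, 0x65432100d, 0x75432100f]⟩, ⟨7, [15, 27, 30, 106, 54,
   60], 39, [0x654321049, 0x765432104a, 0x65432100c, 0x65432100d]⟩, ⟨7, [15, 27, 30, 106, 54], 60,
   [0x65432104b, 0x564321049, 0x562341049]⟩, ⟨7, [15, 27, 30, 106], 10, [0x231043, 0x654321049,
   0x654123049, 0x652341049, 0x65432104c, 0x652143049, 0x65412304c, 0x564321049, 0x564123049,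
   0x562341049, 0x56432104c, 0x562143049, 0x56412304c]⟩, ⟨5, [15, 27, 30], 23, [0x4321044,
   0x65432104d]⟩, ⟨7, [15, 27, 99, 23, 45, 85], 53, [0x563421011, 0x563421010, 0x654321012]⟩, ⟨7,
   [15, 27, 99, 23, 45], 46, [0x531204e, 0x65432104f, 0x65423104f]⟩, ⟨7, [15, 27, 99, 23, 46, 86],
   53, [0x653421050, 0x563421014, 0x654321015, 0x654321013]⟩, ⟨7, [15, 27, 99, 23, 46], 45,
   [0x531204e, 0x654321051, 0x654231051]⟩, ⟨7, [15, 27, 99, 23], 3, [0x654321050, 0x654321052,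
   0x653421050, 0x653421052, 0x652431050, 0x652431052, 0x564321050, 0x564321052, 0x563421050,
   0x563421052, 0x562431050, 0x562431052]⟩, ⟨7, [15, 27, 99, 105, 53, 85], 39, [0x654321016,
   0x562143016]⟩, ⟨7, [15, 27, 99, 105, 53], 43, [0x426315053, 0x654321054]⟩, ⟨7, [15, 27, 99,
   105], 106, [0x361504e, 0x654321055, 0x564321055]⟩, ⟨7, [15, 27, 99, 106, 54, 86], 39,
   [0x654321017, 0x654321018]⟩, ⟨7, [15, 27, 99, 106, 54], 43, [0x653104e, 0x654321057]⟩, ⟨7, [15,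
   27, 99, 106], 105, [0x361504e, 0x654321058, 0x564321058]⟩, ⟨8, [15, 27, 99, 169, 43, 75], 105,
   [0x654321056, 0x876531053, 0x726531053, 0x746531053]⟩, ⟨8, [15, 27, 99, 169, 43, 53, 89], 45,
   [0x645213053, 0x7654321019, 0x765432101a]⟩, ⟨8, [15, 27, 99, 169, 43, 53], 46, [0x532104e,
   0x765432105b, 0x675412305b]⟩, ⟨8, [15, 27, 99, 169, 43], 75, [0x765432105a, 0x765432105c]⟩, ⟨8,
   [15, 27, 99, 169, 86, 53, 46], 39, [0x523104e, 0x765432101b, 0x765432101c]⟩, ⟨8, [15, 27, 99,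
   169, 86, 53, 89], 51, [0x65432101d, 0x65432101e, 0x765432101f, 0x725136401f]⟩, ⟨8, [15, 27, 99,
   169, 86, 53, 147], 39, [0x527431056, 0x765432105f, 0x675412305f, 0x7654321020]⟩, ⟨8, [15, 27,
   99, 169, 86, 53], 46, [0x765432105e, 0x765432105f, 0x7654321060]⟩, ⟨8, [15, 27, 99, 169, 86,
   75, 135], 39, [0x7654321021, 0x7654321022]⟩, ⟨8, [15, 27, 99, 169, 86, 75], 106, [0x563104e,
   0x7654321062, 0x7652341062]⟩, ⟨8, [15, 27, 99, 169, 86, 195], 75, [0x7654321063]⟩, ⟨8, [15, 27,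
   99, 169, 86], 53, [0x7654321061, 0x7654321063, 0x654321059, 0x7654321064]⟩, ⟨9, [15, 27, 99,
   169, 480, 387, 329, 298], 202, [0x876531023, 0x854321059, 0x854123059]⟩, ⟨9, [15, 27, 99, 169,
   480, 387, 329], 195, [0x2837156065, 0x2618375065, 0x87654321066]⟩, ⟨9, [15, 27, 99, 169, 480,
   387], 163, [0x754321056, 0x87654321067]⟩, ⟨9, [15, 27, 99, 169, 480], 105, [0x654321056,
   0x87654321068]⟩, ⟨8, [15, 27, 99, 169], 43, [0x765432105d, 0x7654321065, 0x6754123065,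
   0x87654321069]⟩, ⟨8, [15, 27, 99, 170, 43, 54, 147], 39, [0x745321053, 0x7654321024,
   0x756432106a]⟩, ⟨8, [15, 27, 99, 170, 43, 54], 46, [0x532104e, 0x765432106b, 0x756432106a]⟩,
   ⟨8, [15, 27, 99, 170, 43], 139, [0x735104e, 0x765432106c]⟩, ⟨8, [15, 27, 99, 170, 85, 45, 156],
   54, [0x7654321025]⟩, ⟨8, [15, 27, 99, 170, 85, 45], 39, [0x645312053, 0x765432106e,
   0x756432106a]⟩, ⟨8, [15, 27, 99, 170, 85, 90, 54], 51, [0x654321026, 0x654321027, 0x7654321028,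
   0x756432106a]⟩, ⟨8, [15, 27, 99, 170, 85, 90], 54, [0x7654321070, 0x634104e, 0x654321056,
   0x437651059]⟩, ⟨8, [15, 27, 99, 170, 85], 45, [0x765432106f, 0x7654321071, 0x256743106a,
   0x432765106a]⟩, ⟨8, [15, 27, 99, 170, 156, 46, 90], 54, [0x7654321029, 0x765432102a,
   0x765432102b]⟩, ⟨8, [15, 27, 99, 170, 156, 46, 202], 58, [0x765432102c, 0x765432102d]⟩, ⟨8,
   [15, 27, 99, 170, 156, 46], 45, [0x531204e, 0x7654321073, 0x7654321074]⟩, ⟨8, [15, 27, 99, 170,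
   156, 147, 135], 54, [0x75432102e, 0x657321053, 0x754123059, 0x765432102f]⟩, ⟨8, [15, 27, 99,
   170, 156, 147], 58, [0x7652341075, 0x256743106a, 0x7654321076, 0x756432106a]⟩, ⟨8, [15, 27, 99,
   170, 156], 46, [0x7654321075, 0x7654321072, 0x7654321077, 0x756432106a]⟩, ⟨9, [15, 27, 99, 170,
   480, 387, 330, 298], 202, [0x876531030, 0x854321059, 0x761385032]⟩, ⟨9, [15, 27, 99, 170, 480,
   387, 330], 195, [0x8237651078, 0x865432106a, 0x87654321079]⟩, ⟨9, [15, 27, 99, 170, 480, 387],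
   163, [0x754321059, 0x8765432107a]⟩, ⟨9, [15, 27, 99, 170, 480], 105, [0x654321056,
   0x8765432107b]⟩, ⟨8, [15, 27, 99, 170], 43, [0x765432106d, 0x7654321072, 0x7654321078,
   0x8765432107c]⟩, ⟨7, [15, 27, 99], 23, [0x654321053, 0x765432106a, 0x765432107d, 0x756432106a,
   0x756432107d, 0x654321056, 0x654321059]⟩, ⟨5, [15, 27], 30, [0x432104e, 0x65432107e,
   0x65412307e]⟩, ⟨7, [15, 51, 60, 30, 102, 90], 85, [0x654321032, 0x532107f, 0x654321033,
   0x654321034, 0x654321031]⟩, ⟨9, [15, 51, 60, 30, 102, 166, 58, 298], 39, [0x452107f,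
   0x854321036]⟩, ⟨8, [15, 51, 60, 30, 102, 166, 58], 23, [0x542107f, 0x87654321081, 0x654321035,
   0x754321035]⟩, ⟨8, [15, 51, 60, 30, 102, 166, 204], 45, [0x531207f, 0x7654321037,
   0x6754321037]⟩, ⟨8, [15, 51, 60, 30, 102, 166], 58, [0x7654321082, 0x7654321083]⟩, ⟨7, [15, 51,
   60, 30, 102], 90, [0x654321080, 0x7654321084, 0x452107f, 0x531207f, 0x251407f]⟩, ⟨6, [15, 51,
   60, 30], 29, [0x431207f, 0x654321085, 0x654231085]⟩, ⟨7, [15, 51, 60, 85, 90, 102], 105,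
   [0x543261023, 0x542107f, 0x54321086, 0x32541086, 0x31642086]⟩, ⟨7, [15, 51, 60, 85, 90], 102,
   [0x654321087, 0x432107f, 0x431207f, 0x351407f, 0x362407f]⟩, ⟨7, [15, 51, 60, 85], 90,
   [0x654321088, 0x746207f, 0x452107f, 0x531207f, 0x645207f, 0x564207f]⟩, ⟨7, [15, 51, 60, 86,
   106, 102], 101, [0x31652086, 0x54321086, 0x23541086, 0x543261030]⟩, ⟨7, [15, 51, 60, 86, 106],
   89, [0x654231089, 0x452107f, 0x45321086, 0x32541086, 0x65432108a]⟩, ⟨8, [15, 51, 60, 86, 204,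
   150, 195], 85, [0x71426086, 0x47632108b, 0x7654321038]⟩, ⟨8, [15, 51, 60, 86, 204, 150], 195,
   [0x765432108c, 0x431207f, 0x54321086, 0x45321086]⟩, ⟨8, [15, 51, 60, 86, 204], 106,
   [0x65432108b, 0x431207f, 0x654321089, 0x765432108d]⟩, ⟨7, [15, 51, 60, 86], 23, [0x542107f,
   0x745231089, 0x765432108e, 0x65432108b, 0x763254108e]⟩, ⟨6, [15, 51, 60], 3, [0x654321089,
   0x65432108f, 0x654231089, 0x65423108f, 0x431207f, 0x54321086, 0x645321089, 0x64532108f,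
   0x645231089, 0x64523108f, 0x531207f, 0x45321086, 0x251407f, 0x32541086, 0x351407f,
   0x23541086]⟩, ⟨6, [15, 51], 60, [0x54321090, 0x623107f, 0x632107f, 0x645107f, 0x654107f]⟩, ⟨6,
   [15, 58, 54, 60, 30], 46, [0x5432103a]⟩, ⟨8, [15, 58, 54, 60, 86, 240, 90], 92, [0x65432103b,
   0x54321091]⟩, ⟨8, [15, 58, 54, 60, 86, 240, 166], 102, [0x765432103d, 0x674531203c,
   0x674532103c]⟩, ⟨8, [15, 58, 54, 60, 86, 240], 90, [0x7654321093, 0x54312091, 0x7654321094]⟩,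
   ⟨7, [15, 58, 54, 60, 86], 30, [0x54321092, 0x7654321095]⟩, ⟨6, [15, 58, 54, 60], 48,
   [0x54321039, 0x654321096, 0x423107f, 0x654231096, 0x432107f, 0x654132096, 0x431207f,
   0x54321092, 0x645321096, 0x523107f, 0x645231096, 0x532107f, 0x645132096, 0x531207f,
   0x45321092]⟩, ⟨6, [15, 58, 54], 60, [0x54321097, 0x64321091, 0x65321091]⟩, ⟨8, [15, 58, 86,
   202, 166, 30, 46], 78, [0x765432103e, 0x54312091]⟩, ⟨8, [15, 58, 86, 202, 166, 30], 46,
   [0x7654321099, 0x64213091, 0x74321091]⟩, ⟨8, [15, 58, 86, 202, 166, 240, 102], 106,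
   [0x65321098, 0x54312091, 0x765432103f, 0x76312091]⟩, ⟨8, [15, 58, 86, 202, 166, 240, 156], 108,
   [0x7654321040, 0x74312098, 0x74213098]⟩, ⟨8, [15, 58, 86, 202, 166, 240], 102, [0x765432109b,
   0x64213091, 0x74321091, 0x647523109b, 0x765432109c, 0x75213091]⟩, ⟨8, [15, 58, 86, 202, 166],
   30, [0x765432109a, 0x65321091, 0x75213091, 0x76312091, 0x765432109d]⟩, ⟨8, [15, 58, 86, 202],
   90, [0x64321098, 0x54312091, 0x765432109e, 0x75213091, 0x76312091]⟩, ⟨7, [15, 58, 86], 54,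
   [0x54321098, 0x75213091, 0x76312091, 0x765432109f, 0x632107f, 0x64213091]⟩, ⟨6, [15, 58], 10,
   [0x231043, 0x64321091, 0x6543210a0, 0x423107f, 0x64213091, 0x5642130a0, 0x431207f, 0x65321091,
   0x6453210a0, 0x523107f, 0x65213091, 0x4652130a0, 0x531207f, 0x54321091, 0x54321098, 0x54213091,
   0x54213098]⟩, ⟨4, [15], 6, [0x321043, 0x54321091, 0x54312091, 0x543210a1, 0x432107f,
   0x543120a1, 0x431207f]⟩]

/-- Case distinctions for at most seven hyperedges on seven vertices. -/
def stepsSeven : List Step :=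
  [
   ⟨7, [15, 23, 27, 29, 30, 39, 43], 45, []⟩, ⟨7, [15, 23, 27, 29, 30, 39, 85], 45, []⟩, ⟨7, [15,
   23, 27, 29, 30, 39], 43, [0x654321001, 0x654321002, 0x654320102]⟩, ⟨7, [15, 23, 27, 29, 30],
   39, [0x654321003, 0x562143003, 0x562043103, 0x561043203]⟩, ⟨7, [15, 23, 27, 29], 30,
   [0x654321004]⟩, ⟨7, [15, 23, 27, 99, 39, 43, 83], 51, []⟩, ⟨7, [15, 23, 27, 99, 39, 43], 45,
   [0x645321005, 0x654321006]⟩, ⟨7, [15, 23, 27, 99, 39, 85, 77], 45, []⟩, ⟨7, [15, 23, 27, 99,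
   39, 85, 78], 45, []⟩, ⟨7, [15, 23, 27, 99, 39, 85], 51, [0x653421007, 0x654321008,
   0x654321009]⟩, ⟨7, [15, 23, 27, 99, 39], 43, [0x654321007, 0x65432100a, 0x65432010a]⟩, ⟨7, [15,
   23, 27, 99, 89, 53, 77], 43, []⟩, ⟨7, [15, 23, 27, 99, 89, 53], 51, [0x65324100b,
   0x65432100c]⟩, ⟨7, [15, 23, 27, 99, 89], 75, [0x56423100b, 0x65432100d]⟩, ⟨7, [15, 23, 27, 99],
   39, [0x65432100b, 0x65432100e, 0x65432010e]⟩, ⟨7, [15, 23, 27], 29, [0x654321005,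
   0x65432100f]⟩, ⟨7, [15, 23, 101, 99, 89, 57, 43], 45, []⟩, ⟨7, [15, 23, 101, 99, 89, 57], 43,
   [0x654321011, 0x563412011]⟩, ⟨7, [15, 23, 101, 99, 89], 71, [0x435216010, 0x654321012]⟩, ⟨7,
   [15, 23, 101, 99], 39, [0x436215010, 0x654321013]⟩, ⟨7, [15, 23, 101], 29, [0x654312010,
   0x654321014, 0x654310214]⟩, ⟨7, [15, 23], 27, [0x654321010, 0x654321015, 0x654320115]⟩, ⟨7,
   [15, 105, 102, 90, 85, 51], 60, [0x534621000, 0x546321016, 0x546231016, 0x326541016,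
   0x326451016]⟩, ⟨7, [15, 105, 102, 90, 85], 51, [0x654321017, 0x546132016, 0x546032116,
   0x513064216, 0x403165216]⟩, ⟨7, [15, 105, 102, 90], 43, [0x645231016, 0x654321018,
   0x502164316]⟩, ⟨7, [15, 105, 102], 39, [0x645321016, 0x654321019, 0x654312019]⟩, ⟨7, [15, 105],
   27, [0x654231016, 0x413265016, 0x65432101a, 0x412065316]⟩, ⟨7, [15], 23, [0x654321016,
   0x65432101b, 0x65432011b, 0x65431021b]⟩]

/-- Case distinctions for at most eight hyperedges on eight vertices. -/
def stepsEight : List Step :=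
  [
   ⟨8, [15, 23, 27, 29, 30, 39, 43, 45], 46, []⟩, ⟨8, [15, 23, 27, 29, 30, 39, 43, 83], 51, []⟩,
   ⟨8, [15, 23, 27, 29, 30, 39, 43], 45, [0x7654321001, 0x7654321002, 0x6754321002]⟩, ⟨8, [15, 23,
   27, 29, 30, 39, 85, 147], 51, []⟩, ⟨8, [15, 23, 27, 29, 30, 39, 85], 45, [0x7654312003,
   0x7563214003, 0x7563104203, 0x7654321004, 0x6754310204]⟩, ⟨8, [15, 23, 27, 29, 30, 39], 43,
   [0x7654321003, 0x7654321005, 0x7654320105, 0x6754321005, 0x6754320105]⟩, ⟨8, [15, 23, 27, 29,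
   30], 39, [0x7654321006, 0x7562143006, 0x7562043106, 0x7561043206, 0x6572143006, 0x6572043106,
   0x6571043206]⟩, ⟨8, [15, 23, 27, 29], 30, [0x7654321007]⟩, ⟨8, [15, 23, 27, 99, 135, 39, 71,
   43], 45, []⟩, ⟨8, [15, 23, 27, 99, 135, 39, 71, 85], 45, []⟩, ⟨8, [15, 23, 27, 99, 135, 39,
   71], 43, [0x7654321009, 0x765432100a, 0x765432010a]⟩, ⟨8, [15, 23, 27, 99, 135, 39], 71,
   [0x765432100b]⟩, ⟨8, [15, 23, 27, 99, 135, 156, 45, 46], 53, []⟩, ⟨8, [15, 23, 27, 99, 135,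
   156, 45, 85], 53, []⟩, ⟨8, [15, 23, 27, 99, 135, 156, 45], 46, [0x765432100d, 0x765432100e]⟩,
   ⟨8, [15, 23, 27, 99, 135, 156, 147], 53, [0x765342100f, 0x6510743200]⟩, ⟨8, [15, 23, 27, 99,
   135, 156], 45, [0x765432100f, 0x756342010f, 0x7654321010]⟩, ⟨8, [15, 23, 27, 99, 135], 39,
   [0x765432100c, 0x7654321011]⟩, ⟨8, [15, 23, 27, 99, 57, 58, 156, 45], 46, []⟩, ⟨8, [15, 23, 27,
   99, 57, 58, 156], 45, [0x7654321013, 0x6725014312, 0x7653241012]⟩, ⟨8, [15, 23, 27, 99, 57,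
   58], 43, [0x7625410308, 0x7654321014]⟩, ⟨8, [15, 23, 27, 99, 57, 77, 53, 45], 39, []⟩, ⟨8, [15,
   23, 27, 99, 57, 77, 53, 83], 39, []⟩, ⟨8, [15, 23, 27, 99, 57, 77, 53], 45, [0x7654321016,
   0x7654321017]⟩, ⟨8, [15, 23, 27, 99, 57, 77], 139, [0x7654231012, 0x7654321018, 0x7562431018]⟩,
   ⟨8, [15, 23, 27, 99, 57], 58, [0x7654321015, 0x7654321019, 0x7653421019]⟩, ⟨8, [15, 23, 27,
   99], 135, [0x7654321012, 0x765432101a, 0x765432011a, 0x756432101a, 0x756432011a]⟩, ⟨8, [15, 23,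
   27], 29, [0x7654321008, 0x765432101b, 0x675432101b, 0x576432101b]⟩, ⟨8, [15, 23, 101, 99, 89,
   57, 43, 83], 51, []⟩, ⟨8, [15, 23, 101, 99, 89, 57, 43], 45, [0x764521301c, 0x765432101d]⟩, ⟨8,
   [15, 23, 101, 99, 89, 57], 43, [0x765432101e, 0x756341201e]⟩, ⟨8, [15, 23, 101, 99, 89], 71,
   [0x743521601c, 0x765432101f]⟩, ⟨8, [15, 23, 101, 99], 39, [0x743621501c, 0x7654321020]⟩, ⟨8,
   [15, 23, 101, 163, 39, 57, 83], 54, [0x763540211c, 0x7524361021]⟩, ⟨8, [15, 23, 101, 163, 39,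
   57], 46, [0x764530211c, 0x7654321022, 0x6754312022]⟩, ⟨8, [15, 23, 101, 163, 39], 71,
   [0x743651201c, 0x7654321023]⟩, ⟨8, [15, 23, 101, 163, 92, 198, 57, 154], 46, []⟩, ⟨8, [15, 23,
   101, 163, 92, 198, 57], 154, [0x7654321025]⟩, ⟨8, [15, 23, 101, 163, 92, 198], 57,
   [0x7654321026, 0x5764310224, 0x7654310221, 0x5764310221]⟩, ⟨8, [15, 23, 101, 163, 92, 45, 149,
   53], 54, []⟩, ⟨8, [15, 23, 101, 163, 92, 45, 149], 53, [0x7654321028]⟩, ⟨8, [15, 23, 101, 163,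
   92, 45], 46, [0x764510321c, 0x7654321029, 0x7416325029]⟩, ⟨8, [15, 23, 101, 163, 92], 198,
   [0x7654321027, 0x765432102a, 0x765342102a]⟩, ⟨8, [15, 23, 101, 163], 39, [0x7654321024,
   0x765432102b, 0x675431202b]⟩, ⟨8, [15, 23, 101], 29, [0x765431201c, 0x7654321021, 0x7654310221,
   0x765432102c, 0x675431022c, 0x756432102c, 0x576431022c]⟩, ⟨8, [15, 23], 27, [0x765432101c,
   0x765432102d, 0x765432012d, 0x675432102d, 0x675432012d, 0x576432102d, 0x576432012d]⟩, ⟨8, [15,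
   51, 60, 85, 90, 102, 105, 150], 153, []⟩, ⟨8, [15, 51, 60, 85, 90, 102, 105], 150,
   [0x765432102f]⟩, ⟨8, [15, 51, 60, 85, 90, 102], 105, [0x7654321030, 0x765432102e, 0x765403212e,
   0x730645212e, 0x730546212e]⟩, ⟨8, [15, 51, 60, 85, 90], 102, [0x7654321031, 0x765423102e,
   0x765413202e, 0x762315402e, 0x751326402e]⟩, ⟨8, [15, 51, 60, 85], 90, [0x7654321032,
   0x764532102e, 0x764513202e, 0x731654202e, 0x731546202e, 0x531764202e]⟩, ⟨8, [15, 51, 60], 85,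
   [0x7654321033, 0x764523102e, 0x764503212e, 0x762305412e, 0x7645230133, 0x6754230133,
   0x6745320133, 0x6745231033]⟩, ⟨8, [15, 51], 60, [0x7654321034, 0x754632102e, 0x754623102e,
   0x732654102e, 0x732645102e, 0x654732102e, 0x654723102e, 0x632754102e, 0x632745102e]⟩, ⟨8, [15],
   51, [0x7654321035, 0x754613202e, 0x754603212e, 0x7564103235, 0x7465103235, 0x654713202e,
   0x654703212e, 0x6574103235, 0x6475103235, 0x5476312035, 0x5476302135, 0x5476213035,
   0x5476203135]⟩]

theorem checkCore_coreConfigurations : coreConfigurations.all checkCore = true := by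
  decide +kernel

/-- Here renamings must fix the name `0`, because the conclusion concerns the given vertex: it has a
twin or lies in a core. The table starts with the core configurations, followed by the steps already
checked. -/
theorem checkSteps_coreSteps :
    checkSteps true hasTwinZero coreConfigurations coreSteps = true := by
  decide +kernel

/-- Whether the configuration has more than `n` vertices or more than `n` hyperedges. -/
def exceeds (n : ℕ) (c : Configuration) : Bool :=
  Nat.blt n c.order || (Nat.blt n (quadruples c).length && decide (quadruples c).Nodup)

/-- The hypergraph `fanoComplement` as a configuration. -/
def fanoConfiguration : Configuration := ⟨7, [116, 105, 83, 39, 78, 29, 58]⟩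

/-- The hypergraph `extremalEight` as a configuration. -/
def eightConfiguration : Configuration := ⟨8, [240, 15, 51, 53, 57, 54, 58, 60]⟩

/-- The conclusion, that the Fano complement is realized somewhere, refers to no particular vertex,
so renamings need not fix `0`. -/
theorem checkSteps_stepsSeven :
    checkSteps false (exceeds 7) [fanoConfiguration] stepsSeven = true := by
  decide +kernel

theorem checkSteps_stepsEight :
    checkSteps false (exceeds 8) [eightConfiguration] stepsEight = true := by
  decide +kernel

/-! ### Applying the certificates to a maximal hypergraph -/

/-- In a maximal hypergraph, every covered vertex without twins lies in a core. -/
theorem Maximal4.exists_core {V : Type*} [DecidableEq V] {G : Finset (Finset V)}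
    (hG : Maximal4 G) {x : V} (hx : ∃ f ∈ G, x ∈ f) (hxt : ¬ HasTwin G x) :
    ∃ U, IsCore G ∅ U ∧ x ∈ U := by
  obtain ⟨f, hf, hxf⟩ := hx
  have hcard : (f.erase x).card = 3 := by rw [Finset.card_erase_of_mem hxf, hG.card_eq f hf]
  -- The vertex `x` gets the name `0` and the rest of `f` the names `1, 2, 3`. Thus `f` has mask
  -- `15`, which is the configuration of the last step.
  obtain ⟨ρ, h1, h2, h3⟩ := exists_extension 1 (ρ := fun _ => x)
    (by intro i hi j hj _; simp at hi hj; omega) (f.erase x) (by simp)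
  rw [hcard] at h2 h3
  have h0 : ρ 0 = x := h1 0 one_pos
  have hP : ∀ s ∈ coreSteps, ∀ ρ : ℕ → V, Realizes G ⟨s.order, s.masks⟩ ρ →
      HasTwin G (ρ 0) ∨ ∃ U, IsCore G ∅ U ∧ ρ 0 ∈ U := by
    refine of_checkSteps hG (fun ρ ρ' h hρ => h rfl ▸ hρ) ?_ coreSteps coreConfigurations ?_
      checkSteps_coreSteps
    · intro c ρ hc hρ
      obtain ⟨p, hp, hp0⟩ := List.any_eq_true.1 hc
      exact Or.inl (hρ.hasTwin hp hp0)
    · intro c hc ρ hρ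
      exact Or.inr (hρ.isCore hG (List.all_eq_true.1 checkCore_coreConfigurations c hc))
  have hmem : (⟨4, [15]⟩ : Configuration) ∈
      coreSteps.map (fun s => (⟨s.order, s.masks⟩ : Configuration)) := by
    have : (coreSteps.map (fun s => (⟨s.order, s.masks⟩ : Configuration))).getLast? =
        some ⟨4, [15]⟩ := rfl
    exact List.mem_of_getLast? this
  obtain ⟨s, hs, hs'⟩ := List.mem_map.1 hmem
  have := hP s hs ρ (by
    rw [hs']
    refine ⟨h2, by simp, ?_⟩
    have hb : bits 15 = insert 0 ((Finset.range (1 + 3)).filter (fun i => 1 ≤ i)) := by decide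
    have hn : named ρ 15 = f := by
      rw [named, hb, Finset.image_insert, h3, h0, Finset.insert_erase hxf]
    simpa [hn] using hG.unblocked f hf)
  rw [h0] at this
  exact this.resolve_left hxt

/-- A maximal hypergraph with at most `n` hyperedges on `n` vertices contains one of the hypergraphs
of the table, if this is certified. -/
theorem Maximal4.exists_realizes {n : ℕ} {G : Finset (Finset (Fin n))} (hG : Maximal4 G)
    (hn : 4 ≤ n) (hcard : G.card ≤ n) {c : Configuration} {steps : List Step}
    (hcheck : checkSteps false (exceeds n) [c] steps = true)
    (hlast : (⟨n, [15]⟩ : Configuration) ∈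
      steps.map (fun s => (⟨s.order, s.masks⟩ : Configuration))) :
    ∃ ρ, Realizes G c ρ := by
  have hP : ∀ s ∈ steps, ∀ ρ : ℕ → Fin n, Realizes G ⟨s.order, s.masks⟩ ρ →
      ∃ ρ : ℕ → Fin n, Realizes G c ρ := by
    refine of_checkSteps hG (fun _ _ _ h => h) ?_ steps [c] (by simpa using fun ρ hρ => ⟨ρ, hρ⟩)
      hcheck
    intro d ρ hd hρ
    exfalso
    simp only [exceeds, Bool.or_eq_true, Nat.blt_eq, Bool.and_eq_true, decide_eq_true_eq] at hd
    -- The immediate cases are contradictory: they name more than `n` distinct vertices or exhibit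
    -- more than `n` distinct hyperedges.
    rcases hd with hd | ⟨hd, hnd⟩
    · have := Finset.card_le_univ ((Finset.range d.order).image ρ)
      rw [Finset.card_image_of_injOn (hρ.injOn.mono fun i hi => by simpa using hi)] at this
      simp at this
      omega
    · have hsub : (quadruples d).toFinset.image (named ρ) ⊆ G := by
        intro e he
        obtain ⟨m, hm, rfl⟩ := Finset.mem_image.1 he
        exact (hρ.mem_of_quadruples hG (List.mem_toFinset.1 hm)).2
      have := Finset.card_le_card hsub
      rw [Finset.card_image_of_injOn, List.toFinset_card_of_nodup hnd] at this
      · omega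
      · intro a ha b hb hab
        have ha' := (hρ.mem_of_quadruples hG (List.mem_toFinset.1 ha)).1
        have hb' := (hρ.mem_of_quadruples hG (List.mem_toFinset.1 hb)).1
        exact named_injOn hρ.injOn ha' hb' hab
  obtain ⟨s, hs, hs'⟩ := List.mem_map.1 hlast
  -- If there were no hyperedges, every `4`-set would be unblocked and hence a hyperedge.
  obtain ⟨e, he⟩ : G.Nonempty := by
    by_contra hne
    rw [Finset.not_nonempty_iff_eq_empty] at hne
    obtain ⟨e, -, he⟩ := Finset.exists_subset_card_eq
      (show 4 ≤ (Finset.univ : Finset (Fin n)).card by simpa using hn)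
    have := hG.mem e he (by simp [Unblocked, hne])
    simp [hne] at this
  have he4 := hG.card_eq e he
  obtain ⟨ρ₁, -, h1, h2⟩ := exists_extension 0 (ρ := fun _ => ⟨0, by omega⟩)
    (by intro i hi; simp at hi) e (by simp)
  rw [he4, Nat.zero_add] at h1 h2
  have hb : bits 15 = (Finset.range 4).filter (fun i => 0 ≤ i) := by decide
  have hn15 : named ρ₁ 15 = e := by rw [named, hb, h2]
  have hmem : ∀ i < 4, ρ₁ i ∈ e := fun i hi => by
    rw [← h2]
    exact Finset.mem_image_of_mem _ (by simpa using hi)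
  -- All `n` vertices are named at the start, so cases in which a blocking hyperedge needs a new
  -- name are discarded by `exceeds`.
  obtain ⟨ρ, h3, h4, -⟩ := exists_extension 4 h1 eᶜ
    (fun i hi => by simpa using hmem i hi)
  have hsum : 4 + eᶜ.card = n := by
    have := Finset.card_add_card_compl e
    rw [he4, Fintype.card_fin] at this
    exact this
  rw [hsum] at h4
  refine hP s hs ρ ?_
  rw [hs']
  refine ⟨h4, ?_, ?_⟩
  · simp only [List.mem_singleton, forall_eq]
    calc 15 < 2 ^ 4 := by norm_num
      _ ≤ 2 ^ n := Nat.pow_le_pow_right two_pos hn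
  · simp only [List.mem_singleton, forall_eq]
    rw [named_congr (k := 4) (by norm_num) h3, hn15]
    exact hG.unblocked e he

/-! ### The lower bound -/

section Twins

variable {V : Type*} [DecidableEq V] {G : Finset (Finset V)}

/-- Intersection sizes add over disjoint sets, and a sum equal to `1` would have a summand equal to
`1`. -/
theorem Unblocked.union {s t : Finset V} (hs : Unblocked G s) (ht : Unblocked G t)
    (hst : Disjoint s t) : Unblocked G (s ∪ t) := by
  intro f hf h
  rw [Finset.inter_union_distrib_left, Finset.card_union_of_disjoint
    (hst.mono Finset.inter_subset_right Finset.inter_subset_right)] at h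
  have h1 := hs f hf
  have h2 := ht f hf
  omega

/-- The source of all hyperedges constructed among twins: the union of two disjoint twin pairs is an
unblocked `4`-set. -/
theorem Maximal4.union_mem (hG : Maximal4 G) {a b c d : V} (hab : a ≠ b) (hac : a ≠ c)
    (had : a ≠ d) (hbc : b ≠ c) (hbd : b ≠ d) (hcd : c ≠ d) (h1 : Unblocked G {a, b})
    (h2 : Unblocked G {c, d}) : {a, b, c, d} ∈ G := by
  have he : ({a, b, c, d} : Finset V) = {a, b} ∪ {c, d} := by
    ext; simp only [Finset.mem_insert, Finset.mem_union, Finset.mem_singleton, or_assoc]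
  have hdis : Disjoint ({a, b} : Finset V) {c, d} := by
    simp [Finset.disjoint_left, hac, had, hbc, hbd]
  rw [he]
  refine hG.mem _ ?_ (h1.union h2 hdis)
  rw [Finset.card_union_of_disjoint hdis, Finset.card_pair hab, Finset.card_pair hcd]

/-- There is no class of three twins if there is a further pair of twins. -/
theorem Maximal4.false_of_three_twins (hG : Maximal4 G) {a b c s t : V} (hab : a ≠ b) (hac : a ≠ c)
    (hbc : b ≠ c) (hst : s ≠ t) (hs : s ≠ a ∧ s ≠ b ∧ s ≠ c) (ht : t ≠ a ∧ t ≠ b ∧ t ≠ c)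
    (h1 : Unblocked G {a, b}) (h2 : Unblocked G {b, c}) (h3 : Unblocked G {s, t}) : False := by
  -- The hyperedge `{a, b, s, t}` contains `b` but not its twin `c`.
  have hmem := hG.union_mem hab hs.1.symm ht.1.symm hs.2.1.symm ht.2.1.symm hst h1 h3
  have := ((unblocked_pair_iff hbc).1 h2 _ hmem).1 (by simp)
  simp only [Finset.mem_insert, Finset.mem_singleton] at this
  rcases this with h | h | h | h
  · exact hac h.symm
  · exact hbc h.symm
  · exact hs.2.2 h.symm
  · exact ht.2.2 h.symm

theorem HasTwin.of_unblocked {x y : V} (hxy : x ≠ y) (h : Unblocked G {x, y}) :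
    HasTwin G x ∧ HasTwin G y :=
  ⟨⟨y, hxy.symm, h⟩, ⟨x, hxy, Finset.pair_comm x y ▸ h⟩⟩

/-- Two disjoint pairs of twins. -/
structure TwinPairs (G : Finset (Finset V)) (p p' q q' : V) : Prop where
  left : p ≠ p'
  right : q ≠ q'
  ne₁ : p ≠ q
  ne₂ : p ≠ q'
  ne₃ : p' ≠ q
  ne₄ : p' ≠ q'
  unblocked_left : Unblocked G {p, p'}
  unblocked_right : Unblocked G {q, q'}

/-- A twin of `x` among the four vertices would make `x` part of a class of three twins disjoint
from the other pair. -/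
theorem TwinPairs.partner_notMem (hG : Maximal4 G) {p p' q q' x y : V} (h : TwinPairs G p p' q q')
    (hx : x ∉ ({p, p', q, q'} : Finset V)) (hxy : y ≠ x) (hu : Unblocked G {x, y}) :
    y ∉ ({p, p', q, q'} : Finset V) := by
  simp only [Finset.mem_insert, Finset.mem_singleton, not_or] at hx
  intro hy
  simp only [Finset.mem_insert, Finset.mem_singleton] at hy
  obtain ⟨hl, hr, h1, h2, h3, h4, hul, hur⟩ := h
  have hul' := Finset.pair_comm p p' ▸ hul
  have hur' := Finset.pair_comm q q' ▸ hur
  rcases hy with rfl | rfl | rfl | rfl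
  · exact hG.false_of_three_twins hxy.symm hx.2.1 hl hr ⟨Ne.symm hx.2.2.1, h1.symm, h3.symm⟩
      ⟨Ne.symm hx.2.2.2, h2.symm, h4.symm⟩ hu hul hur
  · exact hG.false_of_three_twins hxy.symm hx.1 hl.symm hr ⟨Ne.symm hx.2.2.1, h3.symm, h1.symm⟩
      ⟨Ne.symm hx.2.2.2, h4.symm, h2.symm⟩ hu hul' hur
  · exact hG.false_of_three_twins hxy.symm hx.2.2.2 hr hl ⟨Ne.symm hx.1, h1, h2⟩
      ⟨Ne.symm hx.2.1, h3, h4⟩ hu hur hul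
  · exact hG.false_of_three_twins hxy.symm hx.2.2.1 hr.symm hl ⟨Ne.symm hx.1, h2, h1⟩
      ⟨Ne.symm hx.2.1, h4, h3⟩ hu hur' hul

theorem card_inter_insert {a : V} {s : Finset V} (ha : a ∉ s) (f : Finset V) :
    (f ∩ insert a s).card = (if a ∈ f then 1 else 0) + (f ∩ s).card := by
  by_cases h : a ∈ f
  · rw [Finset.inter_insert_of_mem h, Finset.card_insert_of_notMem (by simp [ha]), if_pos h,
      Nat.add_comm]
  · rw [Finset.inter_insert_of_notMem h, if_neg h, Nat.zero_add]

theorem card_inter_three {a b c : V} (hab : a ≠ b) (hac : a ≠ c) (hbc : b ≠ c) (f : Finset V) :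
    (f ∩ {a, b, c}).card =
      (if a ∈ f then 1 else 0) + (if b ∈ f then 1 else 0) + (if c ∈ f then 1 else 0) := by
  have h : ({c} : Finset V) = insert c ∅ := rfl
  rw [card_inter_insert (by simp [hab, hac]), card_inter_insert (by simpa using hbc), h,
    card_inter_insert (by simp), Finset.inter_empty, Finset.card_empty, Nat.add_zero, Nat.add_assoc]

theorem card_inter_four {a b c d : V} (hab : a ≠ b) (hac : a ≠ c) (had : a ≠ d) (hbc : b ≠ c)
    (hbd : b ≠ d) (hcd : c ≠ d) (f : Finset V) : (f ∩ {a, b, c, d}).card =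
      (if a ∈ f then 1 else 0) + (if b ∈ f then 1 else 0) + (if c ∈ f then 1 else 0) +
        (if d ∈ f then 1 else 0) := by
  rw [card_inter_insert (by simp [hab, hac, had]), card_inter_three hbc hbd hcd]
  omega

theorem card_four {a b c d : V} (hab : a ≠ b) (hac : a ≠ c) (had : a ≠ d) (hbc : b ≠ c)
    (hbd : b ≠ d) (hcd : c ≠ d) : ({a, b, c, d} : Finset V).card = 4 := by
  rw [← Finset.inter_self {a, b, c, d}, card_inter_four hab hac had hbc hbd hcd]
  simp

theorem exists_eq_insert_of_card_eq_four {a b c : V} (hab : a ≠ b) (hac : a ≠ c) (hbc : b ≠ c)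
    {f : Finset V} (hf : f.card = 4) (ha : a ∈ f) (hb : b ∈ f) (hc : c ∈ f) :
    ∃ d, a ≠ d ∧ b ≠ d ∧ c ≠ d ∧ f = {a, b, c, d} := by
  have hsub : ({a, b, c} : Finset V) ⊆ f := by
    simp [Finset.insert_subset_iff, ha, hb, hc]
  have h3 : ({a, b, c} : Finset V).card = 3 := Finset.card_eq_three.2 ⟨a, b, c, hab, hac, hbc, rfl⟩
  have h1 : (f \ {a, b, c}).card = 1 := by
    rw [Finset.card_sdiff_of_subset hsub, hf, h3]
  obtain ⟨d, hd⟩ := Finset.card_eq_one.1 h1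
  have hdm : d ∈ f \ {a, b, c} := hd ▸ Finset.mem_singleton_self d
  simp only [Finset.mem_sdiff, Finset.mem_insert, Finset.mem_singleton, not_or] at hdm
  refine ⟨d, Ne.symm hdm.2.1, Ne.symm hdm.2.2.1, Ne.symm hdm.2.2.2, ?_⟩
  rw [← Finset.sdiff_union_of_subset hsub, hd]
  ext; simp only [Finset.mem_insert, Finset.mem_union, Finset.mem_singleton]; tauto

/-! ### Consequences of an isolated vertex -/

/-- With an isolated vertex, every triple of other vertices is blocked. -/
theorem Maximal4.exists_blocking_triple (hG : Maximal4 G) {o : V} (ho : ∀ f ∈ G, o ∉ f)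
    {t : Finset V} (ht : t.card = 3) (hot : o ∉ t) : ∃ f ∈ G, (f ∩ t).card = 1 := by
  by_contra hcon
  push Not at hcon
  have ho' : Unblocked G {o} := by
    intro f hf
    simp [ho f hf]
  -- Otherwise the triple together with the isolated vertex is an unblocked `4`-set, hence a
  -- hyperedge through `o`.
  have hmem := hG.mem (t ∪ {o}) (by
    rw [Finset.card_union_of_disjoint (Finset.disjoint_singleton_right.2 hot), ht]; simp)
    (Unblocked.union hcon ho' (Finset.disjoint_singleton_right.2 hot))
  exact ho _ hmem (by simp)

/-- A core with a spare hyperedge. -/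
theorem isCore_six {p q x y z w : V} {s : Finset V} (hpx : p ≠ x)
    (hpy : p ≠ y) (hpz : p ≠ z) (hpw : p ≠ w) (hqx : q ≠ x) (hqy : q ≠ y) (hqz : q ≠ z)
    (hqw : q ≠ w) (hxy : x ≠ y) (hxz : x ≠ z) (hxw : x ≠ w) (hyz : y ≠ z) (hyw : y ≠ w)
    (hzw : z ≠ w) (hp : HasTwin G p) (hq : HasTwin G q) (hpq : Unblocked G {p, q})
    (h1 : {p, q, x, y} ∈ G) (h2 : {p, q, y, z} ∈ G) (h3 : {p, q, x, z} ∈ G)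
    (h4 : {x, y, z, w} ∈ G) (hws : w ∈ s) (hps : p ∈ s) : IsCore G {s} {p, q, x, y, z, w} := by
  have s1 : ({p, q, x, y} : Finset V) ⊆ {p, q, x, y, z, w} := by simp [Finset.insert_subset_iff]
  have s2 : ({p, q, y, z} : Finset V) ⊆ {p, q, x, y, z, w} := by simp [Finset.insert_subset_iff]
  have s3 : ({p, q, x, z} : Finset V) ⊆ {p, q, x, y, z, w} := by simp [Finset.insert_subset_iff]
  have s4 : ({x, y, z, w} : Finset V) ⊆ {p, q, x, y, z, w} := by simp [Finset.insert_subset_iff]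
  have m1 : x ∈ ({p, q, x, y} : Finset V) := by simp
  have m2 : y ∈ ({p, q, y, z} : Finset V) := by simp
  have m3 : z ∈ ({p, q, x, z} : Finset V) := by simp
  have m4 : w ∈ ({x, y, z, w} : Finset V) := by simp
  have n1 : z ∉ ({p, q, x, y} : Finset V) := by simp [hpz.symm, hqz.symm, hxz.symm, hyz.symm]
  have n2 : x ∉ ({p, q, y, z} : Finset V) := by simp [hpx.symm, hqx.symm, hxy, hxz]
  have n3 : y ∉ ({p, q, x, z} : Finset V) := by simp [hpy.symm, hqy.symm, hxy.symm, hyz]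
  have n4 : p ∉ ({x, y, z, w} : Finset V) := by simp [hpx, hpy, hpz, hpw]
  have n4' : q ∉ ({x, y, z, w} : Finset V) := by simp [hqx, hqy, hqz, hqw]
  have w1 : w ∉ ({p, q, x, y} : Finset V) := by simp [hpw.symm, hqw.symm, hxw.symm, hyw.symm]
  have w2 : w ∉ ({p, q, y, z} : Finset V) := by simp [hpw.symm, hqw.symm, hyw.symm, hzw.symm]
  have w3 : w ∉ ({p, q, x, z} : Finset V) := by simp [hpw.symm, hqw.symm, hxw.symm, hzw.symm]
  -- The first three hyperedges differ from `s` because they miss `w`, and `{x, y, z, w}` does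
  -- because it misses `p`. So all four are available as representatives of `x`, `y`, `z`, `w`.
  have hs : ∀ e ∈ G, w ∉ e → e ∉ ({s} : Finset (Finset V)) := by
    intro e _ he hes
    exact he ((Finset.mem_singleton.1 hes) ▸ hws)
  have hs4 : ({x, y, z, w} : Finset V) ∉ ({s} : Finset (Finset V)) := fun hes =>
    n4 ((Finset.mem_singleton.1 hes) ▸ hps)
  refine ⟨?_, ?_, ?_⟩
  · intro v hv
    simp only [Finset.mem_insert, Finset.mem_singleton] at hv
    rcases hv with rfl | rfl | rfl | rfl | rfl | rfl
    exacts [⟨_, h1, s1, by simp⟩, ⟨_, h1, s1, by simp⟩, ⟨_, h1, s1, m1⟩, ⟨_, h2, s2, m2⟩,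
      ⟨_, h3, s3, m3⟩, ⟨_, h4, s4, m4⟩]
  · have sep : ∀ u v, u ∈ ({p, q} : Finset V) → v ∈ ({x, y, z, w} : Finset V) →
        ∃ e ∈ G, e ⊆ ({p, q, x, y, z, w} : Finset V) ∧ ¬ (u ∈ e ↔ v ∈ e) := by
      intro u v hu hv
      refine ⟨_, h4, s4, fun h => ?_⟩
      rw [Finset.mem_insert, Finset.mem_singleton] at hu
      rcases hu with rfl | rfl
      · exact n4 (h.2 hv)
      · exact n4' (h.2 hv)
    have symm : ∀ {u v : V}, (∃ e ∈ G, e ⊆ ({p, q, x, y, z, w} : Finset V) ∧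
        ¬ (u ∈ e ↔ v ∈ e)) → ∃ e ∈ G, e ⊆ ({p, q, x, y, z, w} : Finset V) ∧ ¬ (v ∈ e ↔ u ∈ e) :=
      fun ⟨e, h, h', hne⟩ => ⟨e, h, h', fun hi => hne hi.symm⟩
    have mk : ∀ {u v e}, e ∈ G → e ⊆ ({p, q, x, y, z, w} : Finset V) → u ∈ e → v ∉ e →
        ∃ e ∈ G, e ⊆ ({p, q, x, y, z, w} : Finset V) ∧ ¬ (u ∈ e ↔ v ∈ e) :=
      fun h h' hu hv => ⟨_, h, h', fun hi => hv (hi.1 hu)⟩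
    have sxy := mk h3 s3 (by simp : x ∈ _) n3
    have sxz := mk h1 s1 m1 n1
    have sxw := mk h1 s1 m1 w1
    have syz := mk h1 s1 (by simp : y ∈ _) n1
    have syw := mk h1 s1 (by simp : y ∈ _) w1
    have szw := mk h3 s3 m3 w3
    intro u hu v hv huv
    have hU : ({p, q, x, y, z, w} : Finset V) = {p, q} ∪ {x, y, z, w} := by
      ext; simp only [Finset.mem_insert, Finset.mem_union, Finset.mem_singleton, or_assoc]
    rw [hU, Finset.mem_union] at hu hv
    rcases hu with hu | hu <;> rcases hv with hv | hv
    · left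
      rw [Finset.mem_insert, Finset.mem_singleton] at hu hv
      rcases hu with rfl | rfl <;> rcases hv with rfl | rfl
      exacts [absurd rfl huv, hpq, Finset.pair_comm u v ▸ hpq, absurd rfl huv]
    · exact Or.inr (sep u v hu hv)
    · exact Or.inr (symm (sep v u hv hu))
    · right
      simp only [Finset.mem_insert, Finset.mem_singleton] at hu hv
      rcases hu with rfl | rfl | rfl | rfl <;> rcases hv with rfl | rfl | rfl | rfl
      exacts [absurd rfl huv, sxy, sxz, sxw, symm sxy, absurd rfl huv, syz, syw, symm sxz, symm syz,
        absurd rfl huv, szw, symm sxw, symm syw, symm szw, absurd rfl huv]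
  · refine ⟨fun v => if v = x then {p, q, x, y} else if v = y then {p, q, y, z} else
      if v = z then {p, q, x, z} else {x, y, z, w}, ?_, ?_⟩
    · have hmem : ∀ v, v ∈ ({p, q, x, y, z, w} : Finset V) ∧ ¬ HasTwin G v →
          v = x ∨ v = y ∨ v = z ∨ v = w := by
        rintro v ⟨hv, hvt⟩
        simp only [Finset.mem_insert, Finset.mem_singleton] at hv
        rcases hv with rfl | rfl | hv
        exacts [absurd hp hvt, absurd hq hvt, hv]
      have d12 : ({p, q, x, y} : Finset V) ≠ {p, q, y, z} := fun h => n2 (h ▸ m1)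
      have d13 : ({p, q, x, y} : Finset V) ≠ {p, q, x, z} := fun h => n1 (h ▸ m3)
      have d14 : ({p, q, x, y} : Finset V) ≠ {x, y, z, w} := fun h => w1 (h ▸ m4)
      have d23 : ({p, q, y, z} : Finset V) ≠ {p, q, x, z} := fun h => n3 (h ▸ m2)
      have d24 : ({p, q, y, z} : Finset V) ≠ {x, y, z, w} := fun h => w2 (h ▸ m4)
      have d34 : ({p, q, x, z} : Finset V) ≠ {x, y, z, w} := fun h => w3 (h ▸ m4)
      intro u hu v hv huv
      rcases hmem u hu with rfl | rfl | rfl | rfl <;> rcases hmem v hv with rfl | rfl | rfl | rfl <;>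
        first
        | rfl
        | simp only [hxy, hxz, hyz, hxy.symm, hxz.symm, hxw.symm, hyz.symm,
            hyw.symm, hzw.symm, if_true, if_false] at huv
          first | exact absurd huv ‹_› | exact absurd huv.symm ‹_›
    · intro v hv hvt
      simp only [Finset.mem_insert, Finset.mem_singleton] at hv
      rcases hv with rfl | rfl | rfl | rfl | rfl | rfl
      · exact absurd hp hvt
      · exact absurd hq hvt
      · simp only [if_true]
        exact ⟨h1, hs _ h1 w1, s1, m1⟩
      · simp only [hxy.symm, if_true, if_false]
        exact ⟨h2, hs _ h2 w2, s2, m2⟩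
      · simp only [hxz.symm, hyz.symm, if_true, if_false]
        exact ⟨h3, hs _ h3 w3, s3, m3⟩
      · simp only [hxw.symm, hyw.symm, hzw.symm, if_false]
        exact ⟨h4, hs4, s4, m4⟩

/-- With an isolated vertex, a hyperedge with some but not only vertices with twins leads to a core
with a spare hyperedge. -/
theorem Maximal4.exists_spare (hG : Maximal4 G) {o : V} (ho : ∀ f ∈ G, o ∉ f) {g : Finset V}
    (hg : g ∈ G) {p x : V} (hpg : p ∈ g) (hp : HasTwin G p) (hxg : x ∈ g) (hx : ¬ HasTwin G x) :
    ∃ s U, IsCore G {s} U ∧ s ∈ G ∧ s ⊆ U ∧ ∃ z ∈ s, ¬ HasTwin G z := by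
  obtain ⟨q, hqp, hpq⟩ := hp
  have htw := HasTwin.of_unblocked hqp.symm hpq
  have hiff := (unblocked_pair_iff hqp.symm).1 hpq
  have hpx : p ≠ x := by rintro rfl; exact hx htw.1
  have hqx : q ≠ x := by rintro rfl; exact hx htw.2
  obtain ⟨y, hpy, hqy, hxy, rfl⟩ := exists_eq_insert_of_card_eq_four hqp.symm hpx hqx
    (hG.card_eq g hg) hpg ((hiff g hg).1 hpg) hxg
  -- Stated for general `x`, `y` since the hyperedge separating them may contain either one.
  have key : ∀ x y, p ≠ x → q ≠ x → p ≠ y → q ≠ y → x ≠ y → {p, q, x, y} ∈ G →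
      ∀ f ∈ G, x ∈ f → y ∉ f →
      ∃ s U, IsCore G {s} U ∧ s ∈ G ∧ s ⊆ U ∧ ∃ z ∈ s, ¬ HasTwin G z := by
    clear hxg hx hpx hqx hpy hqy hxy hpg hg x y
    intro x y hpx hqx hpy hqy hxy hg f hf hxf hyf
    have e1 : ∀ k ∈ G, (k ∩ {p, q, x, y}).card ≠ 1 := hG.unblocked _ hg
    have hpf : p ∈ f := by
      by_contra hpf
      have hqf : q ∉ f := fun h => hpf ((hiff f hf).2 h)
      apply e1 f hf
      rw [card_inter_four hqp.symm hpx hpy hqx hqy hxy]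
      simp [hpf, hqf, hxf, hyf]
    obtain ⟨z, hpz, hqz, hxz, rfl⟩ := exists_eq_insert_of_card_eq_four hqp.symm hpx hqx
      (hG.card_eq f hf) hpf ((hiff f hf).1 hpf) hxf
    have hyz : y ≠ z := by rintro rfl; simp at hyf
    have e2 : ∀ k ∈ G, (k ∩ {p, q, x, z}).card ≠ 1 := hG.unblocked _ hf
    simp only [card_inter_four hqp.symm hpx hpy hqx hqy hxy] at e1
    simp only [card_inter_four hqp.symm hpx hpz hqx hqz hxz] at e2
    -- A hyperedge missing `p` and `q` contains both or neither of `x, y`, and likewise of `x, z`;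
    -- so it contains both or neither of `y, z`.
    have hyzG : {p, q, y, z} ∈ G := by
      refine hG.mem _ (card_four hqp.symm hpy hpz hqy hqz hyz) ?_
      intro k hk
      have h1 := e1 k hk
      have h2 := e2 k hk
      have h3 := hiff k hk
      rw [card_inter_four hqp.symm hpy hpz hqy hqz hyz]
      rw [if_congr h3 rfl rfl] at h1 h2 ⊢
      clear e1 e2
      split_ifs at h1 h2 ⊢ <;> omega
    -- A blocking hyperedge contains both or neither of the twins `p, q`, so it contains `x` alone
    -- of this triple. The hyperedges already found then force `y` and `z` into it.
    obtain ⟨h, hh, h1⟩ := hG.exists_blocking_triple ho (t := {p, q, x})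
      (Finset.card_eq_three.2 ⟨p, q, x, hqp.symm, hpx, hqx, rfl⟩)
      (fun hot => ho _ hg (by simp at hot ⊢; tauto))
    rw [card_inter_three hqp.symm hpx hqx] at h1
    have hph : p ∉ h := by
      intro hph
      simp [hph, (hiff h hh).1 hph] at h1
      omega
    have hqh : q ∉ h := fun hqh => hph ((hiff h hh).2 hqh)
    have hxh : x ∈ h := by
      by_contra hxh
      simp [hph, hqh, hxh] at h1
    have hyh : y ∈ h := by
      by_contra hyh
      exact e1 h hh (by simp [hph, hqh, hxh, hyh])
    have hzh : z ∈ h := by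
      by_contra hzh
      exact e2 h hh (by simp [hph, hqh, hxh, hzh])
    obtain ⟨w, hxw, hyw, hzw, rfl⟩ := exists_eq_insert_of_card_eq_four hxy hxz hyz
      (hG.card_eq h hh) hxh hyh hzh
    have hpw : p ≠ w := by rintro rfl; simp at hph
    have hqw : q ≠ w := by rintro rfl; simp at hqh
    have e3 : ∀ k ∈ G, (k ∩ {x, y, z, w}).card ≠ 1 := hG.unblocked _ hh
    simp only [card_inter_four hxy hxz hxw hyz hyw hzw] at e3
    -- This `s` will be the spare hyperedge: it must contain `w`, `p` and `q`, hence exactly one of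
    -- `x, y, z`, and so it stays inside the core.
    obtain ⟨s, hs, hs1⟩ := hG.exists_blocking_triple ho (t := {x, y, z})
      (Finset.card_eq_three.2 ⟨x, y, z, hxy, hxz, hyz, rfl⟩)
      (fun hot => ho _ hh (by simp at hot ⊢; tauto))
    rw [card_inter_three hxy hxz hyz] at hs1
    have hws : w ∈ s := by
      by_contra hws
      exact e3 s hs (by simp [hws, hs1])
    have hps : p ∈ s := by
      by_contra hps
      have hqs : q ∉ s := fun h => hps ((hiff s hs).2 h)
      have h1 := e1 s hs
      have h2 := e2 s hs
      simp only [if_neg hps, if_neg hqs] at h1 h2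
      clear e1 e2 e3
      split_ifs at h1 h2 hs1 <;> omega
    have hqs := (hiff s hs).1 hps
    -- A twin of `w` would be `x`, `y` or `z`, but these lie in hyperedges through `p` and `q` that
    -- miss `w`.
    have hwt : ¬ HasTwin G w := by
      intro hw
      obtain ⟨v, hvw, hv⟩ := hw.exists_iff
      have hvh := (hv _ hh).1 (by simp)
      have hvg := hv _ hg
      have hvf := hv _ hf
      simp only [Finset.mem_insert, Finset.mem_singleton, hpw.symm, hqw.symm, hxw.symm, hyw.symm,
        hzw.symm, or_false, false_iff, not_or] at hvg hvf hvh
      rcases hvh with h | h | h | h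
      exacts [hvg.2.2.1 h, hvg.2.2.2 h, hvf.2.2.2 h, hvw h]
    refine ⟨s, {p, q, x, y, z, w}, isCore_six hpx hpy hpz hpw hqx hqy hqz hqw hxy hxz hxw hyz hyw
      hzw htw.1 htw.2 hpq hg hyzG hf hh hws hps, hs, ?_, w, hws, hwt⟩
    obtain ⟨u, -, -, -, rfl⟩ := exists_eq_insert_of_card_eq_four hqp.symm hpw hqw
      (hG.card_eq s hs) hps hqs hws
    have hu : u = x ∨ u = y ∨ u = z := by
      by_contra hcon
      push Not at hcon
      simp [hpx.symm, hqx.symm, hpy.symm, hqy.symm, hpz.symm, hqz.symm, hxw, hyw, hzw,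
        hcon.1.symm, hcon.2.1.symm, hcon.2.2.symm] at hs1
    intro v hv
    simp only [Finset.mem_insert, Finset.mem_singleton] at hv ⊢
    rcases hv with rfl | rfl | rfl | rfl
    · exact Or.inl rfl
    · exact Or.inr (Or.inl rfl)
    · exact Or.inr (Or.inr (Or.inr (Or.inr (Or.inr rfl))))
    · exact Or.inr (Or.inr (hu.imp_right fun hu => hu.imp_right Or.inl))
  have hnt : ∃ f ∈ G, ¬ (x ∈ f ↔ y ∈ f) := by
    by_contra hcon
    push Not at hcon
    exact hx (HasTwin.of_forall_iff hxy.symm hcon)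
  obtain ⟨f, hf, hfxy⟩ := hnt
  by_cases hxf : x ∈ f
  · exact key x y hpx hqx hpy hqy hxy hg f hf hxf (fun hyf => hfxy (iff_of_true hxf hyf))
  · refine key y x hpy hqy hpx hqx hxy.symm ?_ f hf (by tauto) hxf
    rwa [Finset.pair_comm y x]

/-! ### Counting hyperedges among twins and assembling the lower bound -/

variable [Fintype V]

open Classical in
/-- The vertices that have a twin. -/
noncomputable def twinVertices (G : Finset (Finset V)) : Finset V :=
  Finset.univ.filter (HasTwin G)

theorem mem_twinVertices {x : V} : x ∈ twinVertices G ↔ HasTwin G x := by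
  simp [twinVertices]

/-- A hyperedge through a vertex with a twin also contains that twin. -/
theorem unblocked_twinVertices : Unblocked G (twinVertices G) := by
  intro f hf h
  obtain ⟨x, hx⟩ := Finset.card_eq_one.1 h
  have hxm : x ∈ f ∩ twinVertices G := hx ▸ Finset.mem_singleton_self x
  rw [Finset.mem_inter, mem_twinVertices] at hxm
  obtain ⟨y, hyx, hy⟩ := hxm.2
  have hyf := ((unblocked_pair_iff hyx.symm).1 hy f hf).1 hxm.1
  have : y ∈ f ∩ twinVertices G :=
    Finset.mem_inter.2 ⟨hyf, mem_twinVertices.2 (HasTwin.of_unblocked hyx.symm hy).2⟩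
  rw [hx, Finset.mem_singleton] at this
  exact hyx this

/-- Being twins is transitive. Starting from a pair `x, y`, a third vertex `z` either has a twin
outside the pair or joins its class; in the latter case a fourth vertex `u` completes two disjoint
pairs. -/
theorem exists_twinPairs (h : 4 ≤ (twinVertices G).card) : ∃ p p' q q', TwinPairs G p p' q q' := by
  have hex : ∀ s : Finset V, s.card < 4 → ∃ x ∉ s, ∃ y, y ≠ x ∧ Unblocked G {x, y} := by
    intro s hs
    obtain ⟨x, hx, hxs⟩ := Finset.exists_mem_notMem_of_card_lt_card (lt_of_lt_of_le hs h)
    exact ⟨x, hxs, mem_twinVertices.1 hx⟩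
  have tr : ∀ {a b c : V}, a ≠ b → b ≠ c → a ≠ c → Unblocked G {a, b} → Unblocked G {b, c} →
      Unblocked G {a, c} := by
    intro a b c hab hbc hac h1 h2
    rw [unblocked_pair_iff hac]
    exact fun f hf => ((unblocked_pair_iff hab).1 h1 f hf).trans
      ((unblocked_pair_iff hbc).1 h2 f hf)
  obtain ⟨x, -, y, hyx, hxy⟩ := hex ∅ (by simp)
  obtain ⟨z, hz, w, hwz, hzw⟩ := hex {x, y} (lt_of_le_of_lt Finset.card_le_two (by norm_num))
  simp only [Finset.mem_insert, Finset.mem_singleton, not_or] at hz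
  by_cases hw : w = x ∨ w = y
  · have hxz : Unblocked G {x, z} := by
      rcases hw with rfl | rfl
      · rwa [Finset.pair_comm]
      · exact tr hyx.symm (Ne.symm hz.2) (Ne.symm hz.1) hxy (by rwa [Finset.pair_comm])
    obtain ⟨u, hu, v, hvu, huv⟩ := hex {x, y, z} (lt_of_le_of_lt Finset.card_le_three (by norm_num))
    simp only [Finset.mem_insert, Finset.mem_singleton, not_or] at hu
    by_cases hvz : v = z
    · subst hvz
      exact ⟨x, y, u, v, hyx.symm, hvu.symm, Ne.symm hu.1, Ne.symm hz.1, Ne.symm hu.2.1,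
        Ne.symm hz.2, hxy, huv⟩
    by_cases hvx : v = x
    · subst hvx
      exact ⟨v, y, u, z, hyx.symm, hu.2.2, Ne.symm hu.1, Ne.symm hz.1, Ne.symm hu.2.1, Ne.symm hz.2,
        hxy, tr hu.1 (Ne.symm hz.1) hu.2.2 huv hxz⟩
    by_cases hvy : v = y
    · subst hvy
      exact ⟨x, z, u, v, Ne.symm hz.1, hvu.symm, Ne.symm hu.1, hyx.symm, Ne.symm hu.2.2, hz.2,
        hxz, huv⟩
    · exact ⟨x, y, u, v, hyx.symm, hvu.symm, Ne.symm hu.1, Ne.symm hvx, Ne.symm hu.2.1, Ne.symm hvy,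
        hxy, huv⟩
  · rw [not_or] at hw
    exact ⟨x, y, z, w, hyx.symm, hwz.symm, Ne.symm hz.1, Ne.symm hw.1, Ne.symm hz.2, Ne.symm hw.2,
      hxy, hzw⟩

/-- If there are two disjoint pairs of twins, then at least `d - 3` hyperedges consist of vertices
with twins, where `d` is the number of these vertices; hyperedges disjoint from both pairs are not
needed for this. -/
theorem TwinPairs.card_le (hG : Maximal4 G) {p p' q q' : V}
    (h : TwinPairs G p p' q q') {X : Finset (Finset V)}
    (hX : ∀ e ∈ X, e ∈ G ∧ e ⊆ twinVertices G ∧ p ∉ e ∧ q ∉ e) :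
    (twinVertices G).card + X.card ≤ (G.filter (fun e => e ⊆ twinVertices G)).card + 3 := by
  set D := twinVertices G with hD
  set Q : Finset V := {p, p', q, q'} with hQ
  have hQG : Q ∈ G := hG.union_mem h.left h.ne₁ h.ne₂ h.ne₃ h.ne₄ h.right h.unblocked_left
    h.unblocked_right
  have hpD := HasTwin.of_unblocked h.left h.unblocked_left
  have hqD := HasTwin.of_unblocked h.right h.unblocked_right
  have hQD : Q ⊆ D := by
    intro x hx
    simp only [hQ, Finset.mem_insert, Finset.mem_singleton] at hx
    rw [hD, mem_twinVertices]
    rcases hx with rfl | rfl | rfl | rfl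
    exacts [hpD.1, hpD.2, hqD.1, hqD.2]
  have hτ : ∀ x, ∃ y, x ∈ D → y ≠ x ∧ Unblocked G {x, y} := by
    intro x
    by_cases hx : x ∈ D
    · obtain ⟨y, hy⟩ := mem_twinVertices.1 hx
      exact ⟨y, fun _ => hy⟩
    · exact ⟨x, fun h => absurd h hx⟩
  choose τ hτ using hτ
  have hτD : ∀ x ∈ D \ Q, τ x ∈ D \ Q := by
    intro x hx
    rw [Finset.mem_sdiff] at hx
    have := hτ x hx.1
    exact Finset.mem_sdiff.2 ⟨mem_twinVertices.2 (HasTwin.of_unblocked this.1.symm this.2).2,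
      h.partner_notMem hG hx.2 this.1 this.2⟩
  -- Outside `Q` the twin classes are pairs, as a class of three is incompatible with the pair `p,
  -- p'`.
  have hττ : ∀ x ∈ D \ Q, τ (τ x) = x := by
    intro x hx
    by_contra hne
    have h1 := hτ x (Finset.mem_sdiff.1 hx).1
    have hx2 := hτD x hx
    have h2 := hτ _ (Finset.mem_sdiff.1 hx2).1
    have hx3 := hτD _ hx2
    have hnQ : ∀ y ∈ D \ Q, p ≠ y ∧ p' ≠ y := by
      intro y hy
      rw [Finset.mem_sdiff] at hy
      constructor <;> rintro rfl <;> exact hy.2 (by simp [hQ])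
    exact hG.false_of_three_twins h1.1.symm (Ne.symm hne) h2.1.symm h.left
      ⟨(hnQ x hx).1, (hnQ _ hx2).1, (hnQ _ hx3).1⟩ ⟨(hnQ x hx).2, (hnQ _ hx2).2, (hnQ _ hx3).2⟩
      h1.2 h2.2 h.unblocked_left
  obtain ⟨ι, hι⟩ : ∃ ι : V → ℕ, Function.Injective ι :=
    ⟨fun x => (Fintype.equivFin V x).val, fun x y hxy => by simpa [Fin.val_inj] using hxy⟩
  -- Each twin pair `{x, τ x}` outside `Q` forms hyperedges with `{p, p'}` and with `{q, q'}`; the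
  -- arbitrary numbering `ι` assigns one to `x` and the other to `τ x`. With `Q` itself this gives
  -- `|D| - 4 + 1` hyperedges. All contain `p` or `q`, so they are not in `X`.
  let φ : V → Finset V := fun x =>
    if ι x < ι (τ x) then {p, p', x, τ x} else {q, q', x, τ x}
  have hpQ : p ∈ Q := by simp [hQ]
  have hp'Q : p' ∈ Q := by simp [hQ]
  have hqQ : q ∈ Q := by simp [hQ]
  have hq'Q : q' ∈ Q := by simp [hQ]
  have hne : ∀ y ∈ D \ Q, ∀ z ∈ Q, z ≠ y := by
    rintro y hy z hz rfl
    exact (Finset.mem_sdiff.1 hy).2 hz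
  have hφG : ∀ x ∈ D \ Q, φ x ∈ G := by
    intro x hx
    have h1 := hτ x (Finset.mem_sdiff.1 hx).1
    have hx2 := hτD x hx
    simp only [φ]
    split
    · exact hG.union_mem h.left (hne x hx p hpQ) (hne _ hx2 p hpQ) (hne x hx p' hp'Q)
        (hne _ hx2 p' hp'Q) h1.1.symm h.unblocked_left h1.2
    · exact hG.union_mem h.right (hne x hx q hqQ) (hne _ hx2 q hqQ) (hne x hx q' hq'Q)
        (hne _ hx2 q' hq'Q) h1.1.symm h.unblocked_right h1.2
  have hφD : ∀ x ∈ D \ Q, φ x ⊆ D := by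
    intro x hx y hy
    have hx1 := (Finset.mem_sdiff.1 hx).1
    have hx2 := (Finset.mem_sdiff.1 (hτD x hx)).1
    simp only [φ] at hy
    split at hy <;> simp only [Finset.mem_insert, Finset.mem_singleton] at hy <;>
      rcases hy with rfl | rfl | rfl | rfl <;>
      first | exact hQD hpQ | exact hQD hp'Q | exact hQD hqQ | exact hQD hq'Q | exact hx1 |
        exact hx2
  have hφx : ∀ x, x ∈ φ x := by
    intro x
    simp only [φ]
    split <;> simp
  have hφp : ∀ x ∈ D \ Q, (p ∈ φ x ↔ ι x < ι (τ x)) := by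
    intro x hx
    have h1 := hne x hx p hpQ
    have h2 := hne _ (hτD x hx) p hpQ
    simp only [φ]
    split <;> simp [*, h.ne₁, h.ne₂]
  have hφq : ∀ x ∈ D \ Q, (q ∈ φ x ↔ ¬ ι x < ι (τ x)) := by
    intro x hx
    have h1 := hne x hx q hqQ
    have h2 := hne _ (hτD x hx) q hqQ
    simp only [φ]
    split <;> simp [*, h.ne₁.symm, h.ne₃.symm]
  have hinj : Set.InjOn φ (D \ Q : Finset V) := by
    intro x hx y hy hxy
    rw [Finset.mem_coe] at hx hy
    have hxm : x ∈ φ y := hxy ▸ hφx x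
    have hcase : x = y ∨ x = τ y := by
      simp only [φ] at hxm
      split at hxm <;> simp only [Finset.mem_insert, Finset.mem_singleton] at hxm <;>
        rcases hxm with rfl | rfl | hxm | hxm <;>
        first | exact Or.inl hxm | exact Or.inr hxm | exact absurd rfl (hne _ hx _ hpQ) |
          exact absurd rfl (hne _ hx _ hp'Q) | exact absurd rfl (hne _ hx _ hqQ) |
          exact absurd rfl (hne _ hx _ hq'Q)
    rcases hcase with h1 | h1
    · exact h1
    · exfalso
      have hiff := hφp x hx
      rw [hxy, hφp y hy, h1, hττ y hy] at hiff
      have : ι y ≠ ι (τ y) := fun hι' => (hτ y (Finset.mem_sdiff.1 hy).1).1 (hι hι').symm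
      omega
  have hsub : insert Q ((D \ Q).image φ ∪ X) ⊆ G.filter (fun e => e ⊆ D) := by
    intro e he
    rw [Finset.mem_insert, Finset.mem_union, Finset.mem_image] at he
    rw [Finset.mem_filter]
    rcases he with rfl | ⟨x, hx, rfl⟩ | he
    · exact ⟨hQG, hQD⟩
    · exact ⟨hφG x hx, hφD x hx⟩
    · exact ⟨(hX e he).1, (hX e he).2.1⟩
  have hcard := Finset.card_le_card hsub
  rw [Finset.card_insert_of_notMem, Finset.card_union_of_disjoint, Finset.card_image_of_injOn hinj]
    at hcard
  · have h4 : Q.card = 4 := hG.card_eq Q hQG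
    have h5 := Finset.card_sdiff_add_card_eq_card hQD
    omega
  · rw [Finset.disjoint_left]
    intro e he heX
    obtain ⟨x, hx, rfl⟩ := Finset.mem_image.1 he
    by_cases hlt : ι x < ι (τ x)
    · exact (hX _ heX).2.2.1 ((hφp x hx).2 hlt)
    · exact (hX _ heX).2.2.2 ((hφq x hx).2 hlt)
  · rw [Finset.mem_union, Finset.mem_image]
    rintro (⟨x, hx, hxQ⟩ | hQX)
    · exact (Finset.mem_sdiff.1 hx).2 (hxQ ▸ hφx x)
    · exact (hX Q hQX).2.2.1 hpQ

/-- Distinct representatives for the covered vertices without twins, and hyperedges consisting of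
vertices with twins, are different hyperedges. -/
theorem Maximal4.card_add_card_le (hG : Maximal4 G) {S : Finset (Finset V)} {U₀ : Finset V}
    (h₀ : IsCore G S U₀) (hS : ∀ g ∈ S, g ∈ G ∧ g ⊆ U₀ ∧ ∃ x ∈ g, ¬ HasTwin G x) {A : Finset V}
    (hA : ∀ x ∈ A, (∃ f ∈ G, x ∈ f) ∧ ¬ HasTwin G x) :
    A.card + S.card + (G.filter (fun e => e ⊆ twinVertices G)).card ≤ G.card := by
  obtain ⟨φ, hinj, hφ⟩ := exists_matching hG (fun x hx hxt => hG.exists_core hx hxt) h₀ hS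
  have hsub : A.image φ ∪ S ∪ G.filter (fun e => e ⊆ twinVertices G) ⊆ G := by
    intro e he
    rw [Finset.mem_union, Finset.mem_union, Finset.mem_image] at he
    rcases he with (⟨x, hx, rfl⟩ | he) | he
    · exact (hφ x (hA x hx).1 (hA x hx).2).1
    · exact (hS e he).1
    · exact (Finset.mem_filter.1 he).1
  refine le_trans (le_of_eq ?_) (Finset.card_le_card hsub)
  rw [Finset.card_union_of_disjoint, Finset.card_union_of_disjoint,
    Finset.card_image_of_injOn (hinj.mono fun x hx => hA x hx)]
  · rw [Finset.disjoint_left]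
    intro e he heS
    obtain ⟨x, hx, rfl⟩ := Finset.mem_image.1 he
    exact (hφ x (hA x hx).1 (hA x hx).2).2.1 heS
  · rw [Finset.disjoint_left]
    intro e he heD
    have heD := (Finset.mem_filter.1 heD).2
    rw [Finset.mem_union, Finset.mem_image] at he
    rcases he with ⟨x, hx, rfl⟩ | he
    · exact (hA x hx).2 (mem_twinVertices.1 (heD (hφ x (hA x hx).1 (hA x hx).2).2.2))
    · obtain ⟨-, -, x, hx, hxt⟩ := hS e he
      exact hxt (mem_twinVertices.1 (heD hx))

/-- A maximal hypergraph of order `n` has at least `n - 3` hyperedges. -/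
theorem Maximal4.card_univ_le (hG : Maximal4 G) : Fintype.card V ≤ G.card + 3 := by
  classical
  set D := twinVertices G with hD
  set A := Finset.univ.filter (fun x => (∃ f ∈ G, x ∈ f) ∧ ¬ HasTwin G x) with hA
  set O := Finset.univ.filter (fun x => (∀ f ∈ G, x ∉ f) ∧ ¬ HasTwin G x) with hO
  set B := G.filter (fun e => e ⊆ D) with hB
  have hAmem : ∀ x ∈ A, (∃ f ∈ G, x ∈ f) ∧ ¬ HasTwin G x := fun x hx => (Finset.mem_filter.1 hx).2
  have htotal : Fintype.card V ≤ A.card + D.card + O.card := by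
    rw [← Finset.card_univ]
    refine (Finset.card_le_card ?_).trans ((Finset.card_union_le (A ∪ D) O).trans
      (Nat.add_le_add_right (Finset.card_union_le A D) _))
    intro x _
    by_cases hx : HasTwin G x
    · exact Finset.mem_union_left _ (Finset.mem_union_right _ (mem_twinVertices.2 hx))
    · by_cases hc : ∃ f ∈ G, x ∈ f
      · exact Finset.mem_union_left _ (Finset.mem_union_left _ (by simp [hA, hc, hx]))
      · push Not at hc
        exact Finset.mem_union_right _ (by simp only [hO, Finset.mem_filter]; simp [hx]; exact hc)
  -- Two isolated vertices lie in the same hyperedges, namely none, and are twins.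
  have hO1 : O.card ≤ 1 := by
    rw [Finset.card_le_one]
    intro x hx y hy
    rw [hO, Finset.mem_filter] at hx hy
    by_contra hxy
    exact hx.2.2 (HasTwin.of_forall_iff (Ne.symm hxy)
      (fun f hf => iff_of_false (hx.2.1 f hf) (hy.2.1 f hf)))
  have hbase : A.card + (∅ : Finset (Finset V)).card + B.card ≤ G.card :=
    hG.card_add_card_le (S := ∅) isCore_empty (by simp) hAmem
  rw [Finset.card_empty, Nat.add_zero] at hbase
  by_cases h4 : 4 ≤ D.card
  · obtain ⟨p, p', q, q', hpq⟩ := exists_twinPairs h4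
    have h0 : D.card + (∅ : Finset (Finset V)).card ≤ B.card + 3 :=
      hpq.card_le hG (X := ∅) (by simp)
    rw [Finset.card_empty, Nat.add_zero] at h0
    rcases Nat.eq_zero_or_pos O.card with hO0 | hO0
    · omega
    obtain ⟨o, ho⟩ := Finset.card_pos.1 hO0
    rw [hO, Finset.mem_filter] at ho
    have ho1 := ho.2.1
    have hoD : o ∉ D := fun hoD => ho.2.2 (mem_twinVertices.1 hoD)
    by_cases hmix : ∃ g ∈ G, ∃ y ∈ g, ∃ x ∈ g, HasTwin G y ∧ ¬ HasTwin G x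
    · obtain ⟨g, hg, y, hyg, x, hxg, hy, hx⟩ := hmix
      obtain ⟨s, U, hU, hs⟩ := hG.exists_spare ho1 hg hyg hy hxg hx
      have : A.card + ({s} : Finset (Finset V)).card + B.card ≤ G.card :=
        hG.card_add_card_le hU (by simpa using hs) hAmem
      rw [Finset.card_singleton] at this
      omega
    · push Not at hmix
      -- No hyperedge mixes the two kinds of vertices, so the missing hyperedge has to be found
      -- inside `D`.
      have hgD : ∀ g ∈ G, ∀ y ∈ g, y ∈ D → g ⊆ D := fun g hg y hyg hy x hx =>
        mem_twinVertices.2 (hmix g hg y hyg x hx (mem_twinVertices.1 hy))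
      have hQG := hG.union_mem hpq.left hpq.ne₁ hpq.ne₂ hpq.ne₃ hpq.ne₄ hpq.right
        hpq.unblocked_left hpq.unblocked_right
      have hne : ∀ y ∈ D, o ≠ y := by rintro y hy rfl; exact hoD hy
      have hpD := HasTwin.of_unblocked hpq.left hpq.unblocked_left
      have hqD := HasTwin.of_unblocked hpq.right hpq.unblocked_right
      have hpi := (unblocked_pair_iff hpq.left).1 hpq.unblocked_left
      have hqi := (unblocked_pair_iff hpq.right).1 hpq.unblocked_right
      by_cases hr : ∃ r ∈ D, r ∉ ({p, p', q, q'} : Finset V)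
      · obtain ⟨r, hrD, hr⟩ := hr
        obtain ⟨r', hrr, hru⟩ := mem_twinVertices.1 hrD
        have hr' := hpq.partner_notMem hG hr hrr hru
        have hri := (unblocked_pair_iff hrr.symm).1 hru
        have hr2 := hr
        have hr2' := hr'
        simp only [Finset.mem_insert, Finset.mem_singleton, not_or] at hr2 hr2'
        -- The blocking hyperedge contains exactly one of the three twin pairs. Its other two
        -- vertices therefore lie outside all three, which supplies a fourth pair `x, x'`.
        obtain ⟨f, hf, h1⟩ := hG.exists_blocking_triple ho1 (t := {p, q, r})
          (Finset.card_eq_three.2 ⟨p, q, r, hpq.ne₁, Ne.symm hr2.1, Ne.symm hr2.2.2.1, rfl⟩) (by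
            simp [hne p (mem_twinVertices.2 hpD.1), hne q (mem_twinVertices.2 hqD.1), hne r hrD])
        rw [card_inter_three hpq.ne₁ (Ne.symm hr2.1) (Ne.symm hr2.2.2.1)] at h1
        have hfpi := hpi f hf
        have hfqi := hqi f hf
        have hfri := hri f hf
        have hfD : f ⊆ D := by
          by_cases h2 : p ∈ f
          · exact hgD f hf p h2 (mem_twinVertices.2 hpD.1)
          by_cases h3 : q ∈ f
          · exact hgD f hf q h3 (mem_twinVertices.2 hqD.1)
          by_cases h4 : r ∈ f
          · exact hgD f hf r h4 hrD
          · simp [h2, h3, h4] at h1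
        obtain ⟨x, hxf, hx⟩ : ∃ x ∈ f, x ∉ ({p, p', q, q', r, r'} : Finset V) := by
          by_contra hcon
          push Not at hcon
          have hle : f.card ≤ 2 := by
            by_cases h2 : p ∈ f
            · have h3 : q ∉ f := fun h3 => by simp [h2, h3] at h1; omega
              have h4 : r ∉ f := fun h4 => by simp [h2, h4] at h1
              refine (Finset.card_le_card (t := {p, p'}) fun v hv => ?_).trans Finset.card_le_two
              have := hcon v hv
              simp only [Finset.mem_insert, Finset.mem_singleton] at this ⊢
              rcases this with h | h | rfl | rfl | rfl | rfl
              exacts [Or.inl h, Or.inr h, absurd hv h3, absurd (hfqi.2 hv) h3, absurd hv h4,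
                absurd (hfri.2 hv) h4]
            by_cases h3 : q ∈ f
            · have h4 : r ∉ f := fun h4 => by simp [h3, h4] at h1
              refine (Finset.card_le_card (t := {q, q'}) fun v hv => ?_).trans Finset.card_le_two
              have := hcon v hv
              simp only [Finset.mem_insert, Finset.mem_singleton] at this ⊢
              rcases this with rfl | rfl | h | h | rfl | rfl
              exacts [absurd hv h2, absurd (hfpi.2 hv) h2, Or.inl h, Or.inr h, absurd hv h4,
                absurd (hfri.2 hv) h4]
            · refine (Finset.card_le_card (t := {r, r'}) fun v hv => ?_).trans Finset.card_le_two
              have := hcon v hv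
              simp only [Finset.mem_insert, Finset.mem_singleton] at this ⊢
              rcases this with rfl | rfl | rfl | rfl | h | h
              exacts [absurd hv h2, absurd (hfpi.2 hv) h2, absurd hv h3, absurd (hfqi.2 hv) h3,
                Or.inl h, Or.inr h]
          have := hG.card_eq f hf
          omega
        simp only [Finset.mem_insert, Finset.mem_singleton, not_or] at hx
        obtain ⟨x', hxx, hxu⟩ := mem_twinVertices.1 (hfD hxf)
        have hx' := hpq.partner_notMem hG (by simp [hx]) hxx hxu
        simp only [Finset.mem_insert, Finset.mem_singleton, not_or] at hx'
        have hpr : TwinPairs G p p' r r' := ⟨hpq.left, hrr.symm, Ne.symm hr2.1, Ne.symm hr2'.1,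
          Ne.symm hr2.2.1, Ne.symm hr2'.2.1, hpq.unblocked_left, hru⟩
        have hxr := hpr.partner_notMem hG (by simp [hx]) hxx hxu
        simp only [Finset.mem_insert, Finset.mem_singleton, not_or] at hxr
        replace hxr := hxr.2.2
        -- This hyperedge misses `p` and `q`, so it comes in addition to the `|D| - 3` hyperedges of
        -- `TwinPairs.card_le`.
        have hX := hG.union_mem hrr.symm (Ne.symm hx.2.2.2.2.1) (Ne.symm hxr.1) (Ne.symm hx.2.2.2.2.2)
          (Ne.symm hxr.2) hxx.symm hru hxu
        have h5 : D.card + ({{r, r', x, x'}} : Finset (Finset V)).card ≤ B.card + 3 :=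
          hpq.card_le hG (X := {{r, r', x, x'}}) (by
            simp only [Finset.mem_singleton, forall_eq]
            refine ⟨hX, hgD _ hX r (by simp) hrD, ?_, ?_⟩
            · simp [Ne.symm hr2.1, Ne.symm hr2'.1, Ne.symm hx.1, Ne.symm hx'.1]
            · simp [Ne.symm hr2.2.2.1, Ne.symm hr2'.2.2.1, Ne.symm hx.2.2.1, Ne.symm hx'.2.2.1])
        rw [Finset.card_singleton] at h5
        omega
      · exfalso
        push Not at hr
        -- Now `D` is just the two pairs. A hyperedge blocking this triple misses `p, p'` and
        -- contains `q`; lying inside `D`, it has at most the two vertices `q, q'`.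
        obtain ⟨f, hf, h1⟩ := hG.exists_blocking_triple ho1 (t := {p, p', q})
          (Finset.card_eq_three.2 ⟨p, p', q, hpq.left, hpq.ne₁, hpq.ne₃, rfl⟩) (by
            simp [hne p (mem_twinVertices.2 hpD.1), hne q (mem_twinVertices.2 hqD.1),
              hne p' (mem_twinVertices.2 hpD.2)])
        rw [card_inter_three hpq.left hpq.ne₁ hpq.ne₃] at h1
        have hpf : p ∉ f := by
          intro h2
          simp [h2, (hpi f hf).1 h2] at h1
          omega
        have hpf' : p' ∉ f := fun h2 => hpf ((hpi f hf).2 h2)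
        have hqf : q ∈ f := by
          by_contra h2
          simp [hpf, hpf', h2] at h1
        have hsub : f ⊆ {q, q'} := by
          intro x hx
          have := hr x (hgD f hf q hqf (mem_twinVertices.2 hqD.1) hx)
          simp only [Finset.mem_insert, Finset.mem_singleton] at this ⊢
          rcases this with rfl | rfl | h | h
          · exact absurd hx hpf
          · exact absurd hx hpf'
          · exact Or.inl h
          · exact Or.inr h
        have := (Finset.card_le_card hsub).trans Finset.card_le_two
        rw [hG.card_eq f hf] at this
        omega
  · rcases Nat.eq_zero_or_pos O.card with hO0 | hO0
    · omega
    obtain ⟨o, ho⟩ := Finset.card_pos.1 hO0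
    rw [hO, Finset.mem_filter] at ho
    -- With an isolated vertex every triple of other vertices is blocked, whereas `D` is unblocked.
    have hD3 : D.card ≠ 3 := by
      intro hD3
      obtain ⟨f, hf, h1⟩ := hG.exists_blocking_triple ho.2.1 hD3
        (fun hoD => ho.2.2 (mem_twinVertices.1 hoD))
      exact unblocked_twinVertices f hf h1
    omega

end Twins

/-! ### Bow tie saturation -/

section Saturation

variable {V : Type*} [DecidableEq V] {G : Finset (Finset V)}

theorem exists_of_contains_bowTie (h : Contains (bowTie 4) G) :
    ∃ e ∈ G, ∃ f ∈ G, (e ∩ f).card = 1 := by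
  obtain ⟨φ, hφ⟩ := h
  refine ⟨_, hφ _ (Finset.mem_insert_self _ _), _,
    hφ _ (Finset.mem_insert_of_mem (Finset.mem_singleton_self _)), ?_⟩
  rw [← Finset.map_inter, Finset.card_map]
  decide

theorem contains_bowTie {e f : Finset V} (he : e ∈ G) (hf : f ∈ G) (hce : e.card = 4)
    (hcf : f.card = 4) (h : (e ∩ f).card = 1) : Contains (bowTie 4) G := by
  obtain ⟨v, hv⟩ := Finset.card_eq_one.1 h
  have hvm : v ∈ e ∩ f := hv ▸ Finset.mem_singleton_self v
  rw [Finset.mem_inter] at hvm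
  obtain ⟨a, b, c, hab, hac, hbc, habc⟩ := Finset.card_eq_three.1
    (show (e.erase v).card = 3 by rw [Finset.card_erase_of_mem hvm.1, hce])
  obtain ⟨x, y, z, hxy, hxz, hyz, hxyz⟩ := Finset.card_eq_three.1
    (show (f.erase v).card = 3 by rw [Finset.card_erase_of_mem hvm.2, hcf])
  have h1 : ∀ u ∈ ({a, b, c} : Finset V), u ≠ v ∧ u ∈ e := fun u hu => by
    rwa [← habc, Finset.mem_erase] at hu
  have h2 : ∀ u ∈ ({x, y, z} : Finset V), u ≠ v ∧ u ∈ f := fun u hu => by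
    rwa [← hxyz, Finset.mem_erase] at hu
  have h3 : ∀ u ∈ ({a, b, c} : Finset V), ∀ w ∈ ({x, y, z} : Finset V), u ≠ w := by
    rintro u hu w hw rfl
    have : u ∈ e ∩ f := Finset.mem_inter.2 ⟨(h1 u hu).2, (h2 u hw).2⟩
    rw [hv, Finset.mem_singleton] at this
    exact (h1 u hu).1 this
  have he' : e = {a, b, c, v} := by
    rw [← Finset.insert_erase hvm.1, habc]; ext; simp; tauto
  have hf' : f = {v, x, y, z} := by
    rw [← Finset.insert_erase hvm.2, hxyz]
  simp only [Finset.mem_insert, Finset.mem_singleton, forall_eq_or_imp, forall_eq] at h1 h2 h3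
  -- The common vertex takes position `3`, as in `bowTie 4`.
  have hinj : Function.Injective ![a, b, c, v, x, y, z] := by
    rw [← List.nodup_ofFn]
    simp [*]
    tauto
  change ∃ φ : Fin 7 ↪ V, ∀ e ∈ bowTie 4, e.map φ ∈ G
  refine ⟨⟨_, hinj⟩, ?_⟩
  have hb : (bowTie 4 : Finset (Finset (Fin 7))) = {{0, 1, 2, 3}, {3, 4, 5, 6}} := by decide
  intro s hs
  rw [hb, Finset.mem_insert, Finset.mem_singleton] at hs
  rcases hs with rfl | rfl
  · simpa [Finset.map_insert, ← he'] using he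
  · simpa [Finset.map_insert, ← hf'] using hf

/-- A copy created by adding `e` must use `e`, as `G` contains none, and its other hyperedge is not
`e` because `e` meets itself in four vertices. So it exists exactly when some hyperedge of `G`
blocks `e`. -/
theorem isSaturated_iff : IsSaturated 4 (bowTie 4) G ↔ Maximal4 G := by
  constructor
  · intro h
    refine ⟨h.uniform, fun e he f hf hfe => ?_, fun e he hu => ?_⟩
    · exact h.free (contains_bowTie hf he (h.uniform f hf) (h.uniform e he) hfe)
    · by_contra heG
      obtain ⟨f, hf, g, hg, hfg⟩ := exists_of_contains_bowTie (h.saturated e he heG)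
      rw [Finset.mem_insert] at hf hg
      rcases hf with rfl | hf <;> rcases hg with rfl | hg
      · rw [Finset.inter_self] at hfg
        omega
      · exact hu g hg (by rwa [Finset.inter_comm])
      · exact hu f hf hfg
      · exact h.free (contains_bowTie hf hg (h.uniform f hf) (h.uniform g hg) hfg)
  · intro h
    refine ⟨h.card_eq, fun hc => ?_, fun e he heG => ?_⟩
    · obtain ⟨e, he, f, hf, hef⟩ := exists_of_contains_bowTie hc
      exact h.unblocked f hf e he hef
    · by_contra hc
      refine heG (h.mem e he fun f hf hfe => hc ?_)
      exact contains_bowTie (Finset.mem_insert_of_mem hf) (Finset.mem_insert_self e G)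
        (h.card_eq f hf) he hfe

/-- A hyperedge of `G` is unblocked by `G`, hence by the smaller family `F`, and maximality of `F`
puts it into `F`. -/
theorem Maximal4.eq_of_subset {F : Finset (Finset V)} (hF : Maximal4 F) (hG : Maximal4 G)
    (h : F ⊆ G) : F = G :=
  h.antisymm fun e he => hF.mem e (hG.card_eq e he) fun f hf => hG.unblocked e he f (h hf)

/-- On at most six vertices no two `4`-sets meet in a single vertex. -/
theorem maximal4_iff_of_card_le_six [Fintype V] (hV : Fintype.card V ≤ 6) :
    Maximal4 G ↔ G = Finset.powersetCard 4 Finset.univ := by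
  have key : ∀ e f : Finset V, e.card = 4 → f.card = 4 → (e ∩ f).card ≠ 1 := by
    intro e f he hf
    have h1 := Finset.card_union_add_card_inter e f
    have h2 := Finset.card_le_univ (e ∪ f)
    omega
  constructor
  · intro h
    ext e
    rw [Finset.mem_powersetCard_univ]
    exact ⟨h.card_eq e, fun he => h.mem e he fun f hf => key f e (h.card_eq f hf) he⟩
  · rintro rfl
    refine ⟨fun e he => (Finset.mem_powersetCard.1 he).2, fun e he f hf => ?_,
      fun e he _ => Finset.mem_powersetCard_univ.2 he⟩
    exact key f e (Finset.mem_powersetCard.1 hf).2 (Finset.mem_powersetCard.1 he).2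

end Saturation

/-! ### Hypergraphs given by bit masks -/

/-- Check that a list of masks below `2 ^ n` is, without repetition, a maximal family. -/
def checkMaximal (n : ℕ) (l : List ℕ) : Bool :=
  decide l.Nodup && l.all (fun m => Nat.blt m (2 ^ n) && Nat.beq (popCount n m) 4) &&
    l.all (fun m => compatible m l) &&
    (List.range (2 ^ n)).all fun t => !Nat.beq (popCount n t) 4 || l.contains t || !compatible t l

/-- The subset of `Fin n` with mask `m`. -/
def maskSet (n m : ℕ) : Finset (Fin n) := Finset.univ.filter (fun i => m.testBit i)

theorem named_eq_image_maskSet {V : Type*} [DecidableEq V] {n m : ℕ} (hm : m < 2 ^ n)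
    (ρ : ℕ → V) : named ρ m = (maskSet n m).image (fun i : Fin n => ρ i) := by
  ext x
  simp only [named, maskSet, Finset.mem_image, Finset.mem_filter, Finset.mem_univ, true_and]
  constructor
  · rintro ⟨i, hi, rfl⟩
    exact ⟨⟨i, lt_of_mem_bits hm hi⟩, mem_bits.1 hi, rfl⟩
  · rintro ⟨i, hi, rfl⟩
    exact ⟨i, mem_bits.2 hi, rfl⟩

section Masks

variable {n : ℕ} {l : List ℕ} {ρ : ℕ → Fin n}

theorem exists_named_eq (hρ : Set.InjOn ρ {i | i < n}) (e : Finset (Fin n)) :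
    ∃ m < 2 ^ n, named ρ m = e := by
  have hinj : Function.Injective (fun i : Fin n => ρ i) := fun i j hij =>
    Fin.ext (hρ i.isLt j.isLt hij)
  have hsurj := Finite.surjective_of_injective hinj
  obtain ⟨m, hm, hmb⟩ := exists_bits (((Finset.range n).filter fun i => ρ i ∈ e)) (k := n)
    (by simp +contextual)
  refine ⟨m, hm, ?_⟩
  ext x
  rw [named, hmb, Finset.mem_image]
  constructor
  · rintro ⟨i, hi, rfl⟩
    exact (Finset.mem_filter.1 hi).2
  · intro hx
    obtain ⟨i, rfl⟩ := hsurj x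
    exact ⟨i, by simpa using hx, rfl⟩

theorem maximal4_image_named (hl : checkMaximal n l = true) (hρ : Set.InjOn ρ {i | i < n}) :
    Maximal4 (l.toFinset.image (named ρ)) ∧ (l.toFinset.image (named ρ)).card = l.length := by
  simp only [checkMaximal, compatible, Bool.and_eq_true, decide_eq_true_eq, List.all_eq_true,
    Nat.blt_eq, Nat.beq_eq, Bool.not_eq_true', List.mem_range, Bool.or_eq_true,
    List.contains_iff_mem] at hl
  obtain ⟨⟨⟨hnd, hmask⟩, hcomp⟩, hmax⟩ := hl
  have hρ' : Set.InjOn ρ {i | i < (⟨n, l⟩ : Configuration).order} := hρ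
  refine ⟨⟨?_, ?_, ?_⟩, ?_⟩
  · simp only [Finset.forall_mem_image, List.mem_toFinset]
    intro m hm
    rw [card_named' hρ' (hmask m hm).1]
    exact (hmask m hm).2
  · simp only [Finset.forall_mem_image, Unblocked, List.mem_toFinset]
    intro m hm f hf
    rw [Ne, card_named_inter hρ' (hmask f hf).1 (hmask m hm).1, hcomp f hf m hm]
    simp
  · intro e he hu
    obtain ⟨m, hm, rfl⟩ := exists_named_eq hρ e
    rw [card_named' hρ' hm] at he
    rw [Finset.mem_image]
    rcases hmax m hm with (h | h) | h
    · exact absurd he (Nat.ne_of_beq_eq_false h)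
    · exact ⟨m, List.mem_toFinset.2 h, rfl⟩
    · exfalso
      rw [← Bool.not_eq_true, List.all_eq_true] at h
      refine h fun f hf => ?_
      have := hu _ (Finset.mem_image_of_mem _ (List.mem_toFinset.2 hf))
      rw [Finset.inter_comm, Ne, card_named_inter hρ' hm (hmask f hf).1] at this
      simpa using this
  · rw [Finset.card_image_of_injOn, List.toFinset_card_of_nodup hnd]
    intro a ha b hb hab
    exact named_injOn hρ' (hmask a (by simpa using ha)).1 (hmask b (by simpa using hb)).1 hab

/-- An injective naming of the vertices of `Fin n` by `n` names is a bijection; this translates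
isomorphisms into namings. -/
theorem isomorphic_iff (hn : 0 < n) (hl : ∀ m ∈ l, m < 2 ^ n) {G : Finset (Finset (Fin n))} :
    Isomorphic G (l.toFinset.image (maskSet n)) ↔
      ∃ ρ : ℕ → Fin n, Set.InjOn ρ {i | i < n} ∧ G = l.toFinset.image (named ρ) := by
  constructor
  · rintro ⟨σ, hσ⟩
    let ρ : ℕ → Fin n := fun i => if h : i < n then σ.symm ⟨i, h⟩ else σ.symm ⟨0, hn⟩
    have hρ : ∀ i : Fin n, ρ i = σ.symm i := fun i => dif_pos i.isLt
    refine ⟨ρ, ?_, ?_⟩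
    · intro i hi j hj hij
      have := (hρ ⟨i, hi⟩).symm.trans (hij.trans (hρ ⟨j, hj⟩))
      simpa using this
    · ext e
      rw [hσ, Finset.mem_image, Finset.mem_image]
      refine exists_congr fun m => and_congr_right fun hm => ?_
      rw [named_eq_image_maskSet (hl m (List.mem_toFinset.1 hm)), funext hρ]
      constructor
      · intro h
        rw [h, Finset.map_eq_image, Finset.image_image]
        simp
      · rintro rfl
        rw [Finset.map_eq_image, Finset.image_image]
        simp [Function.comp_def]
  · rintro ⟨ρ, hρ, rfl⟩
    have hinj : Function.Injective (fun i : Fin n => ρ i) := fun i j hij =>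
      Fin.ext (hρ i.isLt j.isLt hij)
    let σ := Equiv.ofBijective _ (Finite.injective_iff_bijective.1 hinj)
    refine ⟨σ.symm, fun e => ?_⟩
    rw [Finset.mem_image, Finset.mem_image]
    refine exists_congr fun m => and_congr_right fun hm => ?_
    rw [named_eq_image_maskSet (hl m (List.mem_toFinset.1 hm))]
    change (maskSet n m).image σ = e ↔ _
    constructor
    · rintro rfl
      rw [Finset.map_eq_image, Finset.image_image]
      simp
    · intro h
      rw [h, Finset.map_eq_image, Finset.image_image]
      simp

/-- Uniqueness from a certificate that every small maximal hypergraph realizes the masks `l`. -/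
theorem Maximal4.isomorphic (hn : 0 < n) {G : Finset (Finset (Fin n))} (hG : Maximal4 G)
    (hl : checkMaximal n l = true) (h : ∃ ρ, Realizes G ⟨n, l⟩ ρ) :
    Isomorphic G (l.toFinset.image (maskSet n)) := by
  obtain ⟨ρ, h⟩ := h
  refine (isomorphic_iff hn h.lt).2 ⟨ρ, h.injOn, Eq.symm ?_⟩
  have hF := (maximal4_image_named hl h.injOn).1
  refine hF.eq_of_subset hG fun e he => hG.mem e (hF.card_eq e he) ?_
  obtain ⟨m, hm, rfl⟩ := Finset.mem_image.1 he
  exact h.unblocked m (List.mem_toFinset.1 hm)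

theorem maximal4_of_isomorphic (hn : 0 < n) {G : Finset (Finset (Fin n))} (hl : checkMaximal n l = true)
    (h : Isomorphic G (l.toFinset.image (maskSet n))) : Maximal4 G ∧ G.card = l.length := by
  have hlt : ∀ m ∈ l, m < 2 ^ n := fun m hm => by
    simp only [checkMaximal, Bool.and_eq_true, List.all_eq_true, Nat.blt_eq] at hl
    exact (hl.1.1.2 m hm).1
  obtain ⟨ρ, hρ, rfl⟩ := (isomorphic_iff hn hlt).1 h
  exact maximal4_image_named hl hρ

theorem exists_maximal4 (hn : 0 < n) (hl : checkMaximal n l = true) :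
    ∃ G : Finset (Finset (Fin n)), Maximal4 G ∧ G.card = l.length :=
  ⟨_, maximal4_of_isomorphic hn hl ⟨Equiv.refl _, fun e => by
    rw [show (Equiv.refl (Fin n)).toEmbedding = Function.Embedding.refl _ from rfl,
      Finset.map_refl]⟩⟩

end Masks

theorem checkMaximal_seven : checkMaximal 7 fanoConfiguration.masks = true := by decide +kernel

theorem checkMaximal_eight : checkMaximal 8 eightConfiguration.masks = true := by decide +kernel

/-- All `4`-subsets of five vertices, and a hyperedge on the other four. -/
theorem checkMaximal_nine : checkMaximal 9 [15, 23, 27, 29, 30, 480] = true := by decide +kernel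

/-- The twin pairs `{1, 2}` and `{6, 7}` form a hyperedge, and each forms hyperedges with the three
pairs from a private triple. This is the `frame` below in other names. -/
theorem checkMaximal_ten : checkMaximal 10 [15, 23, 30, 198, 480, 736, 960] = true := by
  decide +kernel

/-- The complement of the Fano plane and a disjoint hyperedge. -/
theorem checkMaximal_eleven :
    checkMaximal 11 [116, 105, 83, 39, 78, 29, 58, 1920] = true := by decide +kernel

theorem fanoComplement_eq : fanoComplement = fanoConfiguration.masks.toFinset.image (maskSet 7) := by
  decide +kernel

theorem extremalEight_eq : extremalEight = eightConfiguration.masks.toFinset.image (maskSet 8) := by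
  decide +kernel

/-- The bound `≤ 7` serves uniqueness and the lower bound together: a smaller maximal family would
be isomorphic to one with seven hyperedges. -/
theorem isomorphic_fanoComplement_iff {G : Finset (Finset (Fin 7))} :
    Maximal4 G ∧ G.card ≤ 7 ↔ Isomorphic G fanoComplement := by
  rw [fanoComplement_eq]
  constructor
  · rintro ⟨hG, hcard⟩
    refine hG.isomorphic (by norm_num) checkMaximal_seven
      (hG.exists_realizes (by norm_num) hcard checkSteps_stepsSeven ?_)
    have : (stepsSeven.map (fun s => (⟨s.order, s.masks⟩ : Configuration))).getLast? =
        some ⟨7, [15]⟩ := rfl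
    exact List.mem_of_getLast? this
  · intro h
    have := maximal4_of_isomorphic (by norm_num) checkMaximal_seven h
    exact ⟨this.1, this.2.le⟩

theorem isomorphic_extremalEight_iff {G : Finset (Finset (Fin 8))} :
    Maximal4 G ∧ G.card ≤ 8 ↔ Isomorphic G extremalEight := by
  rw [extremalEight_eq]
  constructor
  · rintro ⟨hG, hcard⟩
    refine hG.isomorphic (by norm_num) checkMaximal_eight
      (hG.exists_realizes (by norm_num) hcard checkSteps_stepsEight ?_)
    have : (stepsEight.map (fun s => (⟨s.order, s.masks⟩ : Configuration))).getLast? =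
        some ⟨8, [15]⟩ := rfl
    exact List.mem_of_getLast? this
  · intro h
    have := maximal4_of_isomorphic (by norm_num) checkMaximal_eight h
    exact ⟨this.1, this.2.le⟩

theorem card_of_isomorphic_fanoComplement {G : Finset (Finset (Fin 7))}
    (h : Isomorphic G fanoComplement) : G.card = 7 := by
  rw [fanoComplement_eq] at h
  exact (maximal4_of_isomorphic (by norm_num) checkMaximal_seven h).2

theorem card_of_isomorphic_extremalEight {G : Finset (Finset (Fin 8))}
    (h : Isomorphic G extremalEight) : G.card = 8 := by
  rw [extremalEight_eq] at h
  exact (maximal4_of_isomorphic (by norm_num) checkMaximal_eight h).2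

/-! ### Hypergraphs with `n - 3` hyperedges -/

/-- Seven hyperedges on the vertices `0, …, 9`, where `896` is the mask of `{7, 8, 9}`. They are
`{0, 1, 2, 3}`, three with `{2, 3}` and two of the vertices `4, 5, 6`, and three with `{0, 1}` and
two of the vertices `7, 8, 9`. -/
def frame : List ℕ := [15, 60, 92, 108, 387, 643, 771]

/-- A set that is compatible with the frame and is no hyperedge of it is the part in the frame of
a `4`-set that contains `{7, 8, 9}` or is blocked by `{7, 8, 9, x}` for some `x` outside. -/
theorem frame_complete : (List.range (2 ^ 10)).all (fun t =>
    Nat.blt 4 (popCount 10 t) || !compatible t frame || (frame.contains t) || t == 896 ||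
      (isPow (t &&& 896) && Nat.blt 2 (popCount 10 t)) ||
      (t &&& 896 == 0 && Nat.blt (popCount 10 t) 4)) = true := by
  decide +kernel

theorem frame_compatible : frame.all (fun m => Nat.blt m (2 ^ 10) && Nat.beq (popCount 10 m) 4 &&
    compatible m frame && !isPow (m &&& 896)) = true := by
  decide +kernel

/-- The seven frame hyperedges are joined by the `n - 10` sets `{7, 8, 9, x}` with `x ≥ 10`.
Maximality depends on a set only through its trace on the ten frame vertices and the number of its
outer vertices, so `frame_complete` settles it for all `n` at once. -/
theorem exists_maximal4_of_large {n : ℕ} (hn : 12 ≤ n) :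
    ∃ G : Finset (Finset (Fin n)), Maximal4 G ∧ G.card = n - 3 := by
  let ρ : ℕ → Fin n := fun i => if h : i < n then ⟨i, h⟩ else ⟨0, by omega⟩
  have hρv : ∀ i < n, (ρ i).val = i := fun i hi => by simp only [ρ, dif_pos hi]
  have hρ : Set.InjOn ρ {i | i < (⟨10, frame⟩ : Configuration).order} := by
    intro i hi j hj hij
    simp only [Set.mem_ofPred_eq] at hi hj
    rw [← hρv i (by omega), ← hρv j (by omega), hij]
  have hmem : ∀ (m : ℕ) (x : Fin n), m < 2 ^ 10 → x ∈ named ρ m → x.val < 10 := by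
    intro m x hm hx
    obtain ⟨i, hi, rfl⟩ := Finset.mem_image.1 hx
    have := lt_of_mem_bits hm hi
    rwa [hρv i (by omega)]
  set S : Finset (Fin n) := Finset.univ.filter (fun x => x.val < 10) with hS
  set X : Finset (Fin n) := Finset.univ.filter (fun x => ¬ x.val < 10) with hX
  have hScard : S.card = 10 := by
    have : S = (Finset.range 10).image ρ := by
      ext x
      simp only [hS, Finset.mem_filter, Finset.mem_univ, true_and, Finset.mem_image,
        Finset.mem_range]
      constructor
      · exact fun hx => ⟨x.val, hx, Fin.ext (hρv _ x.isLt)⟩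
      · rintro ⟨i, hi, rfl⟩
        rwa [hρv i (by omega)]
    rw [this, Finset.card_image_of_injOn (hρ.mono fun i hi => by simpa using hi),
      Finset.card_range]
  have hXcard : X.card = n - 10 := by
    have := Finset.card_filter_add_card_filter_not (s := (Finset.univ : Finset (Fin n)))
      (fun x => x.val < 10)
    rw [Finset.card_univ, Fintype.card_fin, ← hS, ← hX, hScard] at this
    omega
  have hXT : ∀ x ∈ X, ∀ m < 2 ^ 10, x ∉ named ρ m := fun x hx m hm h =>
    (Finset.mem_filter.1 hx).2 (hmem m x hm h)
  have hpart : ∀ e : Finset (Fin n), ∃ m < 2 ^ 10, named ρ m = e ∩ S := by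
    intro e
    obtain ⟨m, hm, hmb⟩ := exists_bits ((Finset.range 10).filter fun i => ρ i ∈ e) (k := 10)
      (by simp +contextual)
    refine ⟨m, hm, ?_⟩
    ext x
    rw [named, hmb]
    simp only [Finset.mem_image, Finset.mem_filter, Finset.mem_range, Finset.mem_inter, hS,
      Finset.mem_univ, true_and]
    constructor
    · rintro ⟨i, ⟨hi, hie⟩, rfl⟩
      exact ⟨hie, by rwa [hρv i (by omega)]⟩
    · rintro ⟨hxe, hx⟩
      have := Fin.ext (hρv _ x.isLt)
      exact ⟨x.val, ⟨hx, by rwa [this]⟩, this⟩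
  have hinterS : ∀ (e : Finset (Fin n)) (m : ℕ), m < 2 ^ 10 →
      named ρ m ∩ e = named ρ m ∩ (e ∩ S) := by
    intro e m hm
    ext x
    simp only [Finset.mem_inter, hS, Finset.mem_filter, Finset.mem_univ, true_and]
    exact ⟨fun h => ⟨h.1, h.2, hmem m x hm h.1⟩, fun h => ⟨h.1, h.2.1⟩⟩
  have hfr := frame_compatible
  simp only [List.all_eq_true, Bool.and_eq_true, Nat.blt_eq, Nat.beq_eq, compatible,
    Bool.not_eq_true'] at hfr
  have hcm := frame_complete
  simp only [List.all_eq_true, List.mem_range, Bool.or_eq_true, Bool.and_eq_true, Nat.blt_eq,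
    Bool.not_eq_true', List.contains_iff_mem, beq_iff_eq] at hcm
  have hT : (named ρ 896).card = 3 := by
    rw [card_named' hρ (by norm_num)]
    decide +kernel
  set F := frame.toFinset.image (named ρ) with hF
  set H := X.image (fun x => insert x (named ρ 896)) with hH
  refine ⟨F ∪ H, ⟨?_, ?_, ?_⟩, ?_⟩
  · intro e he
    rcases Finset.mem_union.1 he with he | he
    · obtain ⟨m, hm, rfl⟩ := Finset.mem_image.1 he
      have := hfr m (List.mem_toFinset.1 hm)
      rw [card_named' hρ this.1.1.1]
      exact this.1.1.2
    · obtain ⟨x, hx, rfl⟩ := Finset.mem_image.1 he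
      rw [Finset.card_insert_of_notMem (hXT x hx _ (by norm_num)), hT]
  · have hFH : ∀ m ∈ frame, ∀ x ∈ X, (named ρ m ∩ insert x (named ρ 896)).card ≠ 1 := by
      intro m hm x hx
      have := hfr m hm
      rw [Finset.inter_insert_of_notMem (hXT x hx m this.1.1.1), Ne,
        card_named_inter hρ this.1.1.1 (by norm_num), this.2]
      simp
    intro e he f hf
    rcases Finset.mem_union.1 he with he | he <;> rcases Finset.mem_union.1 hf with hf | hf
    · obtain ⟨a, ha, rfl⟩ := Finset.mem_image.1 he
      obtain ⟨b, hb, rfl⟩ := Finset.mem_image.1 hf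
      have h1 := hfr a (List.mem_toFinset.1 ha)
      have h2 := hfr b (List.mem_toFinset.1 hb)
      rw [Ne, card_named_inter hρ h2.1.1.1 h1.1.1.1, h2.1.2 a (List.mem_toFinset.1 ha)]
      simp
    · obtain ⟨a, ha, rfl⟩ := Finset.mem_image.1 he
      obtain ⟨x, hx, rfl⟩ := Finset.mem_image.1 hf
      rw [Finset.inter_comm]
      exact hFH a (List.mem_toFinset.1 ha) x hx
    · obtain ⟨x, hx, rfl⟩ := Finset.mem_image.1 he
      obtain ⟨a, ha, rfl⟩ := Finset.mem_image.1 hf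
      exact hFH a (List.mem_toFinset.1 ha) x hx
    · obtain ⟨x, hx, rfl⟩ := Finset.mem_image.1 he
      obtain ⟨y, hy, rfl⟩ := Finset.mem_image.1 hf
      have := Finset.card_le_card (Finset.subset_inter (Finset.subset_insert y (named ρ 896))
        (Finset.subset_insert x (named ρ 896)))
      omega
  · intro e he hu
    obtain ⟨m, hm, hme⟩ := hpart e
    have hcardm : (named ρ m).card = popCount 10 m := card_named' hρ hm
    have hsplit : (e ∩ S).card + (e ∩ X).card = 4 := by
      have h1 : e ∩ S = e.filter (fun x => x.val < 10) := by ext x; simp [hS]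
      have h2 : e ∩ X = e.filter (fun x => ¬ x.val < 10) := by ext x; simp [hX]
      exact h1 ▸ h2 ▸ (Finset.card_filter_add_card_filter_not _).trans he
    rw [← hme, hcardm] at hsplit
    have hblock : ∀ f, f < 2 ^ 10 → ((named ρ f ∩ e).card = 1 ↔ isPow (m &&& f) = true) := by
      intro f hf
      rw [hinterS e f hf, ← hme, Finset.inter_comm]
      exact card_named_inter hρ hm hf
    have heS : (e ∩ X).card = 0 → e = named ρ m := by
      intro h0
      rw [Finset.card_eq_zero] at h0
      rw [hme]
      refine (Finset.inter_eq_left.2 fun x hx => ?_).symm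
      by_contra hxS
      have : x ∈ e ∩ X := by simpa [hx, hX, hS] using hxS
      simp [h0] at this
    have hHu : ∀ x ∈ X, (insert x (named ρ 896) ∩ e).card ≠ 1 := fun x hx =>
      hu _ (Finset.mem_union_right _ (Finset.mem_image_of_mem _ hx))
    rcases hcm m hm with ((((h | h) | h) | h) | h) | h
    · omega
    · exfalso
      rw [← Bool.not_eq_true, compatible, List.all_eq_true] at h
      refine h fun f hf => ?_
      have := hu _ (Finset.mem_union_left _
        (Finset.mem_image_of_mem _ (List.mem_toFinset.2 hf)))
      rw [Ne, hblock f (hfr f hf).1.1.1] at this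
      simpa using this
    · have h4 := (hfr m h).1.1.2
      rw [heS (by omega)]
      exact Finset.mem_union_left _ (Finset.mem_image_of_mem _ (List.mem_toFinset.2 h))
    · subst h
      rw [← hcardm, hT] at hsplit
      obtain ⟨x, hx⟩ := Finset.card_eq_one.1 (show (e ∩ X).card = 1 by omega)
      have hxm : x ∈ e ∩ X := hx ▸ Finset.mem_singleton_self x
      rw [Finset.mem_inter] at hxm
      refine Finset.mem_union_right _ (Finset.mem_image.2 ⟨x, hxm.2, ?_⟩)
      refine Finset.eq_of_subset_of_card_le (Finset.insert_subset hxm.1 ?_) ?_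
      · rw [hme]
        exact Finset.inter_subset_left
      · rw [he, Finset.card_insert_of_notMem (hXT x hxm.2 _ (by norm_num)), hT]
    · exfalso
      -- Here `e` has at most one outer vertex, and `n ≥ 12` leaves another outer vertex `x`; then
      -- `{7, 8, 9, x}` meets `e` in one vertex only.
      obtain ⟨x, hx, hxe⟩ := Finset.exists_mem_notMem_of_card_lt_card
        (show (e ∩ X).card < X.card by omega)
      refine hHu x hx ?_
      rw [Finset.insert_inter_of_notMem fun h => hxe (Finset.mem_inter.2 ⟨h, hx⟩),
        hblock _ (by norm_num)]
      exact h.1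
    · exfalso
      -- Here `e` misses `7, 8, 9` and has an outer vertex `x`, so `{7, 8, 9, x}` meets it in `x`
      -- alone.
      obtain ⟨x, hx⟩ := Finset.card_pos.1 (show 0 < (e ∩ X).card by omega)
      rw [Finset.mem_inter] at hx
      refine hHu x hx.2 ?_
      have h0 : named ρ 896 ∩ e = ∅ := by
        rw [hinterS e _ (by norm_num), ← hme, Finset.inter_comm, named_inter hρ hm (by norm_num),
          h.1]
        simp [named, bits]
      rw [Finset.insert_inter_of_mem hx.1, h0]
      simp
  · have h1 : F.card = 7 := by
      rw [hF, Finset.card_image_of_injOn]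
      · rfl
      · intro a ha b hb hab
        exact named_injOn hρ (hfr a (by simpa using ha)).1.1.1 (hfr b (by simpa using hb)).1.1.1 hab
    have h2 : H.card = n - 10 := by
      rw [hH, Finset.card_image_of_injOn, hXcard]
      intro x hx y hy hxy
      have : x ∈ insert y (named ρ 896) := by
        change insert x (named ρ 896) = insert y (named ρ 896) at hxy
        exact hxy ▸ Finset.mem_insert_self x _
      exact (Finset.mem_insert.1 this).resolve_right (hXT x hx _ (by norm_num))
    rw [Finset.card_union_of_disjoint, h1, h2]
    · omega
    · rw [Finset.disjoint_left]
      intro e he he'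
      obtain ⟨m, hm, rfl⟩ := Finset.mem_image.1 he
      obtain ⟨x, hx, hxm⟩ := Finset.mem_image.1 he'
      exact hXT x hx m (hfr m (List.mem_toFinset.1 hm)).1.1.1 (hxm ▸ Finset.mem_insert_self x _)

/-! ### The saturation numbers -/

theorem isSatNumber_iff {n m : ℕ} : IsSatNumber 4 n (bowTie 4) m ↔
    (∃ G : Finset (Finset (Fin n)), Maximal4 G ∧ G.card = m) ∧
      ∀ G : Finset (Finset (Fin n)), Maximal4 G → m ≤ G.card := by
  simp only [IsSatNumber, IsLeast, saturatedSizes, mem_lowerBounds, Set.mem_ofPred_eq,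
    isSaturated_iff, forall_exists_index, and_imp]
  exact and_congr_right fun _ => ⟨fun h G hG => h _ G hG rfl, fun h _ G hG hk => hk ▸ h G hG⟩

theorem isSatNumber_of_le_six {n : ℕ} (hn : n ≤ 6) :
    IsSatNumber 4 n (bowTie 4) (n.choose 4) := by
  have hV : Fintype.card (Fin n) ≤ 6 := by rwa [Fintype.card_fin]
  have hcard : (Finset.powersetCard 4 (Finset.univ : Finset (Fin n))).card = n.choose 4 := by
    rw [Finset.card_powersetCard, Finset.card_univ, Fintype.card_fin]
  refine isSatNumber_iff.2 ⟨⟨_, (maximal4_iff_of_card_le_six hV).2 rfl, hcard⟩, fun G hG => ?_⟩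
  rw [(maximal4_iff_of_card_le_six hV).1 hG, hcard]

theorem isSatNumber_seven : IsSatNumber 4 7 (bowTie 4) 7 := by
  refine isSatNumber_iff.2 ⟨exists_maximal4 (by norm_num) checkMaximal_seven, fun G hG => ?_⟩
  by_contra h
  have := card_of_isomorphic_fanoComplement (isomorphic_fanoComplement_iff.1 ⟨hG, by omega⟩)
  omega

theorem isSatNumber_eight : IsSatNumber 4 8 (bowTie 4) 8 := by
  refine isSatNumber_iff.2 ⟨exists_maximal4 (by norm_num) checkMaximal_eight, fun G hG => ?_⟩
  by_contra h
  have := card_of_isomorphic_extremalEight (isomorphic_extremalEight_iff.1 ⟨hG, by omega⟩)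
  omega

theorem isSatNumber_of_nine_le {n : ℕ} (hn : 9 ≤ n) : IsSatNumber 4 n (bowTie 4) (n - 3) := by
  refine isSatNumber_iff.2 ⟨?_, fun G hG => ?_⟩
  · rcases Nat.lt_or_ge n 12 with h | h
    · interval_cases n
      · exact exists_maximal4 (by norm_num) checkMaximal_nine
      · exact exists_maximal4 (by norm_num) checkMaximal_ten
      · exact exists_maximal4 (by norm_num) checkMaximal_eleven
    · exact exists_maximal4_of_large h
  · have := hG.card_univ_le
    rw [Fintype.card_fin] at this
    omega

end BowTieSaturation

theorem mainTheorem1 :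
    (∀ n : ℕ, BowTieSaturation.IsSatNumber 4 n (BowTieSaturation.bowTie 4)
      (if n ≤ 6 then n.choose 4 else if n ≤ 8 then n else n - 3)) ∧
    (∀ G : Finset (Finset (Fin 7)),
      (BowTieSaturation.IsSaturated 4 (BowTieSaturation.bowTie 4) G ∧ G.card = 7) ↔
        BowTieSaturation.Isomorphic G BowTieSaturation.fanoComplement) ∧
    (∀ G : Finset (Finset (Fin 8)),
      (BowTieSaturation.IsSaturated 4 (BowTieSaturation.bowTie 4) G ∧ G.card = 8) ↔
        BowTieSaturation.Isomorphic G BowTieSaturation.extremalEight) := by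
  open BowTieSaturation in
  refine ⟨fun n => ?_, fun G => ?_, fun G => ?_⟩
  · split_ifs with h6 h8
    · exact isSatNumber_of_le_six h6
    · obtain rfl | rfl : n = 7 ∨ n = 8 := by omega
      exacts [isSatNumber_seven, isSatNumber_eight]
    · exact isSatNumber_of_nine_le (by omega)
  · rw [isSaturated_iff]
    exact ⟨fun h => isomorphic_fanoComplement_iff.1 ⟨h.1, h.2.le⟩, fun h =>
      ⟨(isomorphic_fanoComplement_iff.2 h).1, card_of_isomorphic_fanoComplement h⟩⟩
  · rw [isSaturated_iff]
    exact ⟨fun h => isomorphic_extremalEight_iff.1 ⟨h.1, h.2.le⟩, fun h =>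
      ⟨(isomorphic_extremalEight_iff.2 h).1, card_of_isomorphic_extremalEight h⟩⟩
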